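/- Let $X$ be a smooth complete toric surface over $\mathbb C$, given by a smooth complete fan $\Sigma$ in $\mathbb R^2$ whose rays have primitive generators $v_1,\dots,v_m$ with corresponding torus-invariant divisors $D_1,\dots,D_m$, and let $\mathcal L\in\mathrm{Pic}(X)$, written $\mathcal L=\mathcal O_X(D)$ with a torus-invariant divisor $D=\sum_i d_iD_i$ (every line bundle on $X$ is isomorphic to one of this form). Write $TX(\mathcal L)=TX\otimes\mathcal L$. Let $S=\mathbb C[z_1,\dots,z_m]$ be the homogeneous coordinate ring of $X$ (one variable per ray, graded by $\mathrm{Cl}(X)$), and let $$\Omega_X=\sum_{i<j}\det(v_i,v_j)\Big(\prod_{k\neq i,j}z_k\Big)\,dz_i\wedge dz_j$$ be the volume form of $X$, a nowhere vanishing section of $\Omega^2_X\otimes\mathcal O_X(-K_X)$. For $Y\in H^0(X,TX(\mathcal L))$ the contraction $\alpha=\imath_Y\Omega_X\in H^0(X,\Omega^1_X\otimes\mathcal L\otimes\mathcal O_X(-K_X))$ is written in homogeneous coordinates as $\alpha=\sum_i A_i\,dz_i$ with $A_i\in S$ homogeneous of degree $[D-K_X-D_i]$. The singular scheme $\mathrm{Sing}(\alpha)\subset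 X$ is the closed subscheme defined by the homogeneous ideal $J(\alpha)=\langle A_1,\dots,A_m\rangle\subset S$. A singular point is a point $x\in X$ with $\alpha(x)=0$; it is a Kupka point if moreover $d\alpha(x)\neq0$, where $d\alpha=\sum_{i<j}\big(\tfrac{\partial A_j}{\partial z_i}-\tfrac{\partial A_i}{\partial z_j}\big)dz_i\wedge dz_j$ is evaluated at homogeneous coordinates of $x$. Suppose that $TX(\mathcal L)$ is generated by its global sections. Then there is a non-empty Zariski open subset $U\subset H^0(X,TX(\mathcal L))$ such that for every $Y\in U$ and $\alpha=\imath_Y\Omega_X$ the scheme $\mathrm{Sing}(\alpha)$ is reduced and every singular point of $\alpha$ is a Kupka point. -/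

import Mathlib

noncomputable section

namespace ToricSurface

open MvPolynomial

/-- The lattice `ℤ²`, used both for one-parameter subgroups (`N`) and for characters (`M`). -/
abbrev Lattice := Fin 2 → ℤ

/-- The standard pairing `⟨m, v⟩` between a character and a one-parameter subgroup. -/
def pairing (m v : Lattice) : ℤ := m 0 * v 0 + m 1 * v 1

lemma pairing_add (m m' v : Lattice) : pairing (m + m') v = pairing m v + pairing m' v := by
  simp only [pairing, Pi.add_apply]; ring

lemma pairing_zero (v : Lattice) : pairing 0 v = 0 := by
  simp [pairing]

/-- The real cone spanned by a finite set of lattice vectors. -/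
def realCone (σ : Finset Lattice) : Set (Fin 2 → ℝ) :=
  {x | ∃ c : Lattice → ℝ, (∀ v, 0 ≤ c v) ∧ x = ∑ v ∈ σ, c v • fun i => (v i : ℝ)}

/-- A smooth complete fan in `ℝ²`. A smooth cone is recorded by the finite set of the primitive
generators of its rays, which is a part of a `ℤ`-basis of the lattice; the faces of such a cone are
the cones spanned by the subsets of that set. -/
structure SmoothCompleteFan where
  cones : Finset (Finset Lattice)
  smooth : ∀ σ ∈ cones, ∃ b : Module.Basis (Fin 2) ℤ Lattice, (σ : Set Lattice) ⊆ Set.range b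
  face : ∀ σ ∈ cones, ∀ τ, τ ⊆ σ → τ ∈ cones
  inter : ∀ σ ∈ cones, ∀ τ ∈ cones, realCone σ ∩ realCone τ = realCone (σ ∩ τ)
  complete : ∀ x : Fin 2 → ℝ, ∃ σ ∈ cones, x ∈ realCone σ

/-- The rays of the fan, given by their primitive generators. -/
abbrev Ray (F : SmoothCompleteFan) := {v : Lattice // {v} ∈ F.cones}

instance (F : SmoothCompleteFan) : Fintype (Ray F) :=
  Fintype.ofInjective (fun v : Ray F => (⟨{v.1}, v.2⟩ : {σ // σ ∈ F.cones})) (by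
    intro v w h
    exact Subtype.ext (Finset.singleton_injective (congrArg Subtype.val h)))

/-! ### The affine charts and the sheaves `𝒪(D)` and `TX(D)` on them

Every chart `U_σ` of the toric surface `X` contains the torus `T`, and all the sheaves below are
torsion free, so that a section over `U_σ` is the same as a section over `T` that satisfies a
regularity condition along `U_σ`, and sections over different charts agree on the overlap exactly
when they are equal on `T`. -/

/-- The coordinate ring `ℂ[M]` of the torus `T`. -/
abbrev TorusRing := AddMonoidAlgebra ℂ Lattice

/-- The character `χ^m`. -/
def character (m : Lattice) : TorusRing := AddMonoidAlgebra.single m 1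

/-- The coordinate ring `ℂ[σ^∨ ∩ M]` of the affine chart `U_σ`. -/
def chartRing (σ : Finset Lattice) : Subalgebra ℂ TorusRing where
  carrier := {f | ∀ m, f.coeff m ≠ 0 → ∀ v ∈ σ, 0 ≤ pairing m v}
  mul_mem' := by
    classical
    intro f g hf hg m hm v hv
    obtain ⟨a, ha, b, hb, rfl⟩ := Finset.mem_add.1
      (AddMonoidAlgebra.support_coeff_mul_subset f g (Finsupp.mem_support_iff.2 hm))
    rw [pairing_add]
    exact add_nonneg (hf a (Finsupp.mem_support_iff.1 ha) v hv)
      (hg b (Finsupp.mem_support_iff.1 hb) v hv)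
  add_mem' := by
    intro f g hf hg m hm v hv
    by_cases h : f.coeff m = 0
    · refine hg m (fun h' => hm ?_) v hv
      simp [h, h']
    · exact hf m h v hv
  algebraMap_mem' := by
    intro r m hm v hv
    have : m = 0 := by
      by_contra h
      apply hm
      rw [AddMonoidAlgebra.coe_algebraMap]
      simp [Ne.symm h]
    rw [this, pairing_zero]

variable (F : SmoothCompleteFan)

/-- The sections over `U_σ` of the line bundle `𝒪_X(D)`, for the torus invariant divisor
`D = ∑ ρ, D ρ • D_ρ`: the functions `f` on the torus with `div f + D ≥ 0` on `U_σ`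
(the function `χ^m` vanishes to order `⟨m, ρ⟩` along `D_ρ`). -/
def lineBundleSections (D : Ray F → ℤ) (σ : Finset Lattice) : Submodule ℂ TorusRing where
  carrier := {f | ∀ m, f.coeff m ≠ 0 → ∀ ρ : Ray F, ρ.1 ∈ σ → -D ρ ≤ pairing m ρ.1}
  zero_mem' := by
    intro m hm
    exact absurd (by simp) hm
  add_mem' := by
    intro f g hf hg m hm ρ hρ
    by_cases h : f.coeff m = 0
    · refine hg m (fun h' => hm ?_) ρ hρ
      simp [h, h']
    · exact hf m h ρ hρ
  smul_mem' := by
    intro c f hf m hm ρ hρ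
    refine hf m (fun h => hm ?_) ρ hρ
    simp [h]

/-- The sections over `U_σ` of `TX(D) = TX ⊗ 𝒪_X(D)`: the derivations of `𝒪_X(U_σ)` with values in
the invertible module `𝒪_X(D)(U_σ)`. Such a derivation extends uniquely to the torus. -/
def tangentSections (D : Ray F → ℤ) (σ : Finset Lattice) :
    Submodule ℂ (Derivation ℂ TorusRing TorusRing) where
  carrier := {Y | ∀ f ∈ chartRing σ, Y f ∈ lineBundleSections F D σ}
  zero_mem' := by
    intro f _
    exact Submodule.zero_mem _
  add_mem' := by
    intro Y Z hY hZ f hf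
    exact Submodule.add_mem _ (hY f hf) (hZ f hf)
  smul_mem' := by
    intro c Y hY f hf
    exact Submodule.smul_mem _ c (hY f hf)

/-- The space `H⁰(X, TX(D))` of global sections. -/
def globalTangentSections (D : Ray F → ℤ) :
    Submodule ℂ (Derivation ℂ TorusRing TorusRing) :=
  ⨅ σ ∈ F.cones, tangentSections F D σ

/-- `TX(D)` is generated by its global sections: on every affine chart they generate the module of
sections over the coordinate ring. -/
def TangentGloballyGenerated (D : Ray F → ℤ) : Prop :=
  ∀ σ ∈ F.cones, ∀ Y ∈ tangentSections F D σ,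
    Y ∈ Submodule.span (chartRing σ)
      (globalTangentSections F D : Set (Derivation ℂ TorusRing TorusRing))

/-! ### Homogeneous coordinates -/

/-- The homogeneous coordinate ring `S = ℂ[z_ρ]`, with one variable for every ray. -/
abbrev CoxRing := MvPolynomial (Ray F) ℂ

/-- The ring `ℂ[z_ρ, z_ρ⁻¹]` of Laurent polynomials in the homogeneous coordinates. -/
abbrev CoxLaurent := AddMonoidAlgebra ℂ (Ray F → ℤ)

/-- The inclusion of `S` into the Laurent polynomials. -/
def toCoxLaurent : CoxRing F →ₐ[ℂ] CoxLaurent F :=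
  aeval fun ρ => AddMonoidAlgebra.single (Pi.single ρ 1) 1

/-- The exponents of the monomial `∏ ρ, z_ρ ^ ⟨m, ρ⟩`, which is the pullback of `χ^m`. -/
def charExponent : Lattice →+ (Ray F → ℤ) where
  toFun m ρ := pairing m ρ.1
  map_zero' := funext fun ρ => pairing_zero ρ.1
  map_add' m m' := funext fun ρ => pairing_add m m' ρ.1

/-- The pullback of functions from the torus of `X` to the torus of the homogeneous coordinates,
`χ^m ↦ ∏ ρ, z_ρ ^ ⟨m, ρ⟩`. -/
def pullback : TorusRing →ₐ[ℂ] CoxLaurent F :=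
  AddMonoidAlgebra.mapDomainAlgHom ℂ ℂ (charExponent F)

/-- The homogeneous polynomial of degree `[E]` that represents a global section `g` of `𝒪_X(E)`:
`χ^m` becomes `∏ ρ, z_ρ ^ (⟨m, ρ⟩ + E ρ)`. All these exponents are nonnegative if `g` is a global
section of `𝒪_X(E)`, and then the truncation of negative exponents by `Int.toNat` is void. -/
def homogenize (E : Ray F → ℤ) (g : TorusRing) : CoxRing F :=
  g.coeff.sum fun m c =>
    monomial (Finsupp.equivFunOnFinite.symm fun ρ => (pairing m ρ.1 + E ρ).toNat) c

/-- `dlog χ^m (Y) = χ^(-m) Y(χ^m)`. -/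
def dlog (m : Lattice) (Y : Derivation ℂ TorusRing TorusRing) : TorusRing :=
  character (-m) * Y (character m)

/-- The contraction of the `2`-form `dlog χ^(1,0) ∧ dlog χ^(0,1)` on the torus with `Y` and with the
invariant vector field `χ^m ↦ ⟨m, v⟩ χ^m` of the one-parameter subgroup `v`. -/
def torusContraction (Y : Derivation ℂ TorusRing TorusRing) (v : Lattice) : TorusRing :=
  (v 1 : ℂ) • dlog ![1, 0] Y - (v 0 : ℂ) • dlog ![0, 1] Y

/-- The coefficients `A_ρ ∈ S` of the twisted `1`-form `α = ι_Y Ω_X = ∑ ρ, A_ρ dz_ρ`, for a global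
section `Y` of `TX(D)`. Here `Ω_X = ∑_{i < j} det(v_i, v_j) ẑ_ij dz_i ∧ dz_j`, where `ẑ_ij` is the
product of the variables other than `z_i` and `z_j`; this is the form
`ι_{R_1} ⋯ ι_{R_s} (dz_1 ∧ ⋯ ∧ dz_m)`, up to a sign. Since the pullback of `dlog χ^m` is
`∑ ρ, ⟨m, ρ⟩ dz_ρ / z_ρ`, the form `Ω_X` is `∏ z_ρ` times the pullback of
`dlog χ^(1,0) ∧ dlog χ^(0,1)`. Hence `A_ρ` is the homogeneous polynomial that represents
`torusContraction Y ρ` as a section of `𝒪_X(D - K_X - D_ρ)`, with `-K_X = ∑ τ, D_τ`. -/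
def contractVolume (D : Ray F → ℤ) (Y : Derivation ℂ TorusRing TorusRing) (ρ : Ray F) : CoxRing F :=
  homogenize F (fun τ => D τ + 1 - if τ = ρ then 1 else 0) (torusContraction Y ρ.1)

/-! Two checks of the preceding definition: no exponent in it is truncated, and it is the contraction
with `Ω_X` in homogeneous coordinates. -/

/-- The Laurent monomial with exponents `e` in the homogeneous coordinates. -/
abbrev zMonomial {F} (e : Ray F → ℤ) : CoxLaurent F := AddMonoidAlgebra.single e 1

lemma toCoxLaurent_monomial (e : Ray F →₀ ℕ) (c : ℂ) :
    toCoxLaurent F (monomial e c) = AddMonoidAlgebra.single (fun ρ => (e ρ : ℤ)) c := by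
  classical
  have key : ∀ s : Finset (Ray F), (∏ ρ ∈ s, (AddMonoidAlgebra.single (Pi.single ρ (1:ℤ)) 1 : CoxLaurent F) ^ e ρ)
      = AddMonoidAlgebra.single (∑ ρ ∈ s, (e ρ) • Pi.single ρ (1:ℤ)) 1 := by
    intro s
    induction s using Finset.induction_on with
    | empty => simp [AddMonoidAlgebra.one_def]
    | insert a s ha ih =>
      rw [Finset.prod_insert ha, ih, Finset.sum_insert ha, AddMonoidAlgebra.single_pow,
        AddMonoidAlgebra.single_mul_single, one_pow, one_mul]
  rw [toCoxLaurent, aeval_monomial, Finsupp.prod_fintype _ _ (by simp), key]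
  rw [AddMonoidAlgebra.coe_algebraMap]
  simp only [Function.comp, AddMonoidAlgebra.single_mul_single]
  simp only [Algebra.algebraMap_self, RingHom.id_apply, mul_one, zero_add]
  congr 1
  funext ρ
  simp [Finset.sum_apply, Pi.single_apply]

lemma toCoxLaurent_homogenize (E : Ray F → ℤ) (g : TorusRing)
    (hg : ∀ m, g.coeff m ≠ 0 → ∀ ρ : Ray F, 0 ≤ pairing m ρ.1 + E ρ) :
    toCoxLaurent F (homogenize F E g) = zMonomial E * pullback F g := by
  classical
  have h2 : pullback F g = g.coeff.sum fun m c => AddMonoidAlgebra.single (charExponent F m) c := by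
    apply AddMonoidAlgebra.coeff_injective
    change Finsupp.mapDomain (charExponent F) g.coeff = _
    rw [Finsupp.sum, AddMonoidAlgebra.coeff_sum]
    rfl
  rw [h2, homogenize, Finsupp.sum, Finsupp.sum, map_sum, Finset.mul_sum]
  refine Finset.sum_congr rfl fun m hm => ?_
  rw [toCoxLaurent_monomial, AddMonoidAlgebra.single_mul_single, one_mul]
  congr 1
  funext ρ
  have := hg m (Finsupp.mem_support_iff.1 hm) ρ
  simp only [Finsupp.equivFunOnFinite_symm_apply_apply, Int.toNat_of_nonneg this]
  simp [charExponent, add_comm]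

lemma character_mul (m n : Lattice) : character m * character n = character (m + n) := by
  simp [character, AddMonoidAlgebra.single_mul_single]

lemma dlog_add (m n : Lattice) (Y : Derivation ℂ TorusRing TorusRing) :
    dlog (m + n) Y = dlog m Y + dlog n Y := by
  have h0 : character (0 : Lattice) = 1 := rfl
  have h1 : character (-(m+n)) * character m = character (-n) := by
    rw [character_mul]; congr 1; abel
  have h2 : character (-(m+n)) * character n = character (-m) := by
    rw [character_mul]; congr 1; abel
  simp only [dlog]
  rw [← character_mul m n, Derivation.leibniz, smul_eq_mul, smul_eq_mul, mul_add,
    ← mul_assoc, ← mul_assoc, h1, h2, add_comm]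

/-- `dlog` is additive in the character. -/
def dlogHom (Y : Derivation ℂ TorusRing TorusRing) : Lattice →+ TorusRing :=
  AddMonoidHom.mk' (fun m => dlog m Y) fun m n => dlog_add m n Y

lemma dlog_eq (m : Lattice) (Y : Derivation ℂ TorusRing TorusRing) :
    dlog m Y = (m 0 : ℂ) • dlog ![1, 0] Y + (m 1 : ℂ) • dlog ![0, 1] Y := by
  have hm : m = m 0 • ![1, 0] + m 1 • ![0, 1] := by
    funext i; fin_cases i <;> simp
  have : dlogHom Y m = m 0 • dlogHom Y ![1, 0] + m 1 • dlogHom Y ![0, 1] := by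
    conv_lhs => rw [hm]
    rw [map_add, map_zsmul, map_zsmul]
  rw [Int.cast_smul_eq_zsmul, Int.cast_smul_eq_zsmul]
  exact this

lemma torusContraction_eq (v : Lattice) (Y : Derivation ℂ TorusRing TorusRing) :
    torusContraction Y v = dlog ![v 1, - v 0] Y := by
  rw [dlog_eq]; simp [torusContraction, sub_eq_add_neg]

/-- Regularity of `dlog χ^m (Y)` along the divisor of a ray. -/
lemma dlog_coeff {D : Ray F → ℤ} {Y : Derivation ℂ TorusRing TorusRing}
    (hY : Y ∈ globalTangentSections F D) (ρ : Ray F) (m : Lattice) (hm : 0 ≤ pairing m ρ.1)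
    (k : Lattice) (hk : (dlog m Y).coeff k ≠ 0) : -D ρ ≤ pairing (k + m) ρ.1 := by
  have h := hY
  simp only [globalTangentSections, Submodule.mem_iInf] at h
  have h1 := h {ρ.1} ρ.2 (character m) (by
    intro n hn v hv
    have : n = m := by
      by_contra hne
      exact hn (by simp [character, Ne.symm hne])
    rw [Finset.mem_singleton.1 hv, this]; exact hm)
  refine h1 (k + m) ?_ ρ (Finset.mem_singleton_self _)
  have : (dlog m Y).coeff k = (Y (character m)).coeff (k + m) := by
    rw [dlog, character, AddMonoidAlgebra.coeff_single_mul_eq_mul_coeff (m₂ := k + m), one_mul]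
    intro n _
    constructor
    · rintro rfl; abel
    · rintro rfl; abel
  rwa [← this]

lemma dlog_coeff' {D : Ray F → ℤ} {Y : Derivation ℂ TorusRing TorusRing}
    (hY : Y ∈ globalTangentSections F D) (ρ : Ray F) (m : Lattice)
    (k : Lattice) (hk : (dlog m Y).coeff k ≠ 0) : -D ρ - 1 ≤ pairing k ρ.1 := by
  obtain ⟨b, hb⟩ := F.smooth _ ρ.2
  obtain ⟨i, hi⟩ := hb (by simp : ρ.1 ∈ (({ρ.1} : Finset Lattice) : Set Lattice))
  set n : Lattice := ![b.coord i ![1, 0], b.coord i ![0, 1]] with hn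
  have hn1 : pairing n ρ.1 = 1 := by
    have h1 : b.coord i ρ.1 = 1 := by rw [← hi]; simp
    have h2 : ρ.1 = ρ.1 0 • ![1, 0] + ρ.1 1 • ![0, 1] := by
      funext i; fin_cases i <;> simp
    rw [h2, map_add, map_smul, map_smul] at h1
    simp only [smul_eq_mul] at h1
    simp only [pairing, hn, Matrix.cons_val_zero, Matrix.cons_val_one]
    linarith
  have e : dlogHom Y m = dlogHom Y (m - pairing m ρ.1 • n) + pairing m ρ.1 • dlogHom Y n := by
    rw [← map_zsmul, ← map_add]; congr 1; abel
  have p0 : pairing (m - pairing m ρ.1 • n) ρ.1 = 0 := by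
    have : pairing (m - pairing m ρ.1 • n) ρ.1 = pairing m ρ.1 - pairing m ρ.1 * pairing n ρ.1 := by
      simp only [pairing, Pi.sub_apply, Pi.smul_apply, smul_eq_mul]; ring
    rw [this, hn1]; ring
  by_cases h : (dlog (m - pairing m ρ.1 • n) Y).coeff k = 0
  · have h' : (dlog n Y).coeff k ≠ 0 := by
      intro h0
      apply hk
      change (dlogHom Y m).coeff k = 0
      rw [e]
      change (dlog (m - pairing m ρ.1 • n) Y + pairing m ρ.1 • dlog n Y).coeff k = 0
      rw [AddMonoidAlgebra.coeff_add, Finsupp.add_apply, h, zero_add, AddMonoidAlgebra.coeff_smul,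
        Finsupp.smul_apply, h0, smul_zero]
    have := dlog_coeff F hY ρ n (by rw [hn1]; norm_num) k h'
    rw [pairing_add, hn1] at this
    linarith
  · have := dlog_coeff F hY ρ _ p0.ge k h
    rw [pairing_add, p0] at this
    linarith

/-- The exponents in the definition of `contractVolume` are nonnegative. -/
lemma contractVolume_exponent_nonneg {D : Ray F → ℤ} {Y : Derivation ℂ TorusRing TorusRing}
    (hY : Y ∈ globalTangentSections F D) (ρ : Ray F) (m : Lattice)
    (hm : (torusContraction Y ρ.1).coeff m ≠ 0) (τ : Ray F) :
    0 ≤ pairing m τ.1 + (D τ + 1 - if τ = ρ then 1 else 0) := by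
  rw [torusContraction_eq] at hm
  split_ifs with h
  · subst h
    have p0 : pairing ![τ.1 1, -τ.1 0] τ.1 = 0 := by simp [pairing]; ring
    have := dlog_coeff F hY τ _ p0.ge m hm
    rw [pairing_add, p0] at this
    linarith
  · have := dlog_coeff' F hY τ _ m hm
    linarith

/-- `contractVolume` is the contraction with `Ω_X = ∑_{i < j} det(v_i, v_j) ẑ_ij dz_i ∧ dz_j`: if
`∑ ρ, B ρ ∂/∂z_ρ` is a lift of `Y` to the torus of the homogeneous coordinates (with values twisted
by `D`), then `A_ρ = ∑ τ, det(v_τ, v_ρ) ẑ_τρ B_τ`. -/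
theorem toCoxLaurent_contractVolume {D : Ray F → ℤ} {Y : Derivation ℂ TorusRing TorusRing}
    (hY : Y ∈ globalTangentSections F D) (B : Ray F → CoxLaurent F)
    (hB : ∀ m : Lattice, ∑ ρ : Ray F, (pairing m ρ.1 : ℂ) •
        (AddMonoidAlgebra.single (-Pi.single ρ 1 : Ray F → ℤ) (1 : ℂ) * B ρ) =
      AddMonoidAlgebra.single D 1 * pullback F (dlog m Y)) (ρ : Ray F) :
    toCoxLaurent F (contractVolume F D Y ρ) = ∑ τ : Ray F,
      ((τ.1 0 * ρ.1 1 - τ.1 1 * ρ.1 0 : ℤ) : ℂ) •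
        (AddMonoidAlgebra.single (1 - Pi.single τ 1 - Pi.single ρ 1 : Ray F → ℤ) (1 : ℂ) * B τ) := by
  rw [contractVolume, toCoxLaurent_homogenize F _ _ (contractVolume_exponent_nonneg F hY ρ)]
  have h := hB ![ρ.1 1, -ρ.1 0]
  rw [← torusContraction_eq] at h
  have e1 : (AddMonoidAlgebra.single (fun τ => D τ + 1 - if τ = ρ then 1 else 0) 1 : CoxLaurent F)
      = AddMonoidAlgebra.single (1 - Pi.single ρ 1 : Ray F → ℤ) 1 * AddMonoidAlgebra.single D 1 := by
    rw [AddMonoidAlgebra.single_mul_single, one_mul]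
    congr 1
    funext τ
    simp [Pi.single_apply]; ring
  rw [zMonomial, e1, mul_assoc, ← h, Finset.mul_sum]
  refine Finset.sum_congr rfl fun τ _ => ?_
  rw [mul_smul_comm, ← mul_assoc, AddMonoidAlgebra.single_mul_single, one_mul]
  congr 2
  · simp [pairing]; ring
  · congr 1; abel

/-! ### The singular scheme -/

/-- The singular ideal `J(α)` of `α = ∑ ρ, A ρ dz_ρ`, generated by the coefficients. -/
def singularIdeal (A : Ray F → CoxRing F) : Ideal (CoxRing F) := Ideal.span (Set.range A)

/-- The localization `S_σ` of `S` at `∏_{ρ ∉ σ} z_ρ`: the Laurent polynomials in which the variables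
`z_ρ` with `ρ ∈ σ` occur only with nonnegative exponents. -/
def coxLocalization (σ : Finset Lattice) : Subalgebra ℂ (CoxLaurent F) where
  carrier := {f | ∀ e, f.coeff e ≠ 0 → ∀ ρ : Ray F, ρ.1 ∈ σ → 0 ≤ e ρ}
  mul_mem' := by
    classical
    intro f g hf hg m hm ρ hρ
    obtain ⟨a, ha, b, hb, rfl⟩ := Finset.mem_add.1
      (AddMonoidAlgebra.support_coeff_mul_subset f g (Finsupp.mem_support_iff.2 hm))
    exact add_nonneg (hf a (Finsupp.mem_support_iff.1 ha) ρ hρ)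
      (hg b (Finsupp.mem_support_iff.1 hb) ρ hρ)
  add_mem' := by
    intro f g hf hg m hm ρ hρ
    by_cases h : f.coeff m = 0
    · refine hg m (fun h' => hm ?_) ρ hρ
      simp [h, h']
    · exact hf m h ρ hρ
  algebraMap_mem' := by
    intro r m hm ρ hρ
    have : m = 0 := by
      by_contra h
      apply hm
      rw [AddMonoidAlgebra.coe_algebraMap]
      simp [Ne.symm h]
    simp [this]

lemma toCoxLaurent_mem (σ : Finset Lattice) (f : CoxRing F) :
    toCoxLaurent F f ∈ coxLocalization F σ := by
  classical
  induction f using MvPolynomial.induction_on with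
  | C a =>
    rw [toCoxLaurent, ← MvPolynomial.algebraMap_eq, AlgHom.commutes]
    exact Subalgebra.algebraMap_mem _ a
  | add p q hp hq => rw [map_add]; exact Subalgebra.add_mem _ hp hq
  | mul_X p n hp =>
    rw [map_mul]
    refine Subalgebra.mul_mem _ hp ?_
    intro e he ρ _
    rw [toCoxLaurent, aeval_X, AddMonoidAlgebra.coeff_single, Finsupp.single_apply] at he
    have h : Pi.single n 1 = e := by
      by_contra h
      simp [h] at he
    rw [← h, Pi.single_apply]
    split_ifs <;> norm_num

lemma pullback_mem (σ : Finset Lattice) (f : chartRing σ) :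
    pullback F f.1 ∈ coxLocalization F σ := by
  classical
  intro e he ρ hρ
  have h1 : (pullback F f.1).coeff = Finsupp.mapDomain (charExponent F) f.1.coeff := rfl
  rw [h1] at he
  obtain ⟨m, hm, rfl⟩ := Finset.mem_image.1
    (Finsupp.mapDomain_support (Finsupp.mem_support_iff.2 he))
  exact f.2 m (Finsupp.mem_support_iff.1 hm) ρ.1 hρ

/-- The localization map `S → S_σ`. -/
def coxToLocalization (σ : Finset Lattice) : CoxRing F →ₐ[ℂ] coxLocalization F σ :=
  (toCoxLaurent F).codRestrict _ (toCoxLaurent_mem F σ)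

/-- The identification of the coordinate ring of `U_σ` with the degree zero part of `S_σ`. -/
def chartToLocalization (σ : Finset Lattice) : chartRing σ →ₐ[ℂ] coxLocalization F σ :=
  ((pullback F).comp (chartRing σ).val).codRestrict _ (pullback_mem F σ)

/-- The ideal, in the coordinate ring of `U_σ`, of the closed subscheme of `X` that is defined by a
homogeneous ideal `J` of `S`: the degree zero part of `J S_σ`. -/
def chartIdeal (J : Ideal (CoxRing F)) (σ : Finset Lattice) : Ideal (chartRing σ) :=
  (J.map (coxToLocalization F σ)).comap (chartToLocalization F σ)

/-- The closed subscheme of `X` defined by the homogeneous ideal `J` is reduced. -/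
def SubschemeReduced (J : Ideal (CoxRing F)) : Prop :=
  ∀ σ ∈ F.cones, IsReduced (chartRing σ ⧸ chartIdeal F J σ)

/-! ### Points and the Kupka condition -/

/-- `z` is a vector of homogeneous coordinates of a (closed) point of `X`, that is, it does not lie
in the zero set of the irrelevant ideal `⟨∏_{ρ ∉ σ} z_ρ : σ ∈ Σ⟩`. -/
def IsCoordinateVector (z : Ray F → ℂ) : Prop :=
  ∃ σ ∈ F.cones, ∀ ρ : Ray F, ρ.1 ∉ σ → z ρ ≠ 0

/-- The point of `X` with homogeneous coordinates `z` is a singular point of `∑ ρ, A ρ dz_ρ`. -/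
def IsSingularPoint (A : Ray F → CoxRing F) (z : Ray F → ℂ) : Prop :=
  IsCoordinateVector F z ∧ ∀ ρ, eval z (A ρ) = 0

/-- The coefficient of `dz_ρ ∧ dz_τ` in `d (∑ ρ, A ρ dz_ρ)`. -/
def extDerivCoeff (A : Ray F → CoxRing F) (ρ τ : Ray F) : CoxRing F :=
  pderiv ρ (A τ) - pderiv τ (A ρ)

/-- The point with homogeneous coordinates `z` is a Kupka point of `α = ∑ ρ, A ρ dz_ρ`: a singular
point at which `dα` does not vanish. -/
def IsKupkaPoint (A : Ray F → CoxRing F) (z : Ray F → ℂ) : Prop :=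
  IsSingularPoint F A z ∧ ∃ ρ τ, eval z (extDerivCoeff F A ρ τ) ≠ 0

/-! ### Genericity -/

/-- The polynomial functions on a complex vector space. -/
def polynomialFunctions (V : Type*) [AddCommGroup V] [Module ℂ V] : Subalgebra ℂ (V → ℂ) :=
  Algebra.adjoin ℂ {f | ∃ φ : Module.Dual ℂ V, f = φ}

/-- A subset of a complex vector space is Zariski open if its complement is the common zero set of a
set of polynomial functions. -/
def IsZariskiOpen {V : Type*} [AddCommGroup V] [Module ℂ V] (U : Set V) : Prop :=
  ∃ P : Set (V → ℂ), P ⊆ polynomialFunctions V ∧ U = {Y | ∃ f ∈ P, f Y ≠ 0}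

end ToricSurface

end

/-! On the affine plane of a two-dimensional cone, with coordinates `x₀`, `x₁` and the monomial
generator of `𝒪(D)`, a global section `Y` of `TX(D)` is a polynomial vector field `(p₀, p₁)`. There
the singular scheme of `α` is cut out by `p₀` and `p₁`, since the coefficients of `α` at the two
rays of the cone are units times `p₁` and `p₀` (`chartIdeal_singularIdeal`). At a singular point the
`dz₀ ∧ dz₁` coefficient of `dα` is a nonzero factor times the divergence `∂p₀/∂x₀ + ∂p₁/∂x₁`
(`isKupkaPoint`). It therefore suffices that, for general `Y` and each of finitely many charts,
neither the Jacobian determinant nor the divergence vanishes at a zero of `(p₀, p₁)`. A nonzero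
Jacobian at all zeros makes the ideal radical (`isRadical_span_of_jacobian_ne_zero`).

Global generation enters through the torus grading: it forces the constant fields `∂/∂x_i` of every
chart to be global sections (`coordinateField_mem`). The linear system is then stable under adding
constants to `(p₀, p₁)`, so zeros of a general member behave like a general fibre of a polynomial
map. The required Sard-type statement is algebraic. For `n` polynomials `G` in `n` variables, any
nonzero polynomial `t`, and also the Jacobian determinant of `G`, divides some `h(G)` with `h ≠ 0`
(`exists_dvd_aeval`, `exists_jacobian_dvd_aeval`). At a point where `G = u` and `h(u) ≠ 0`, the
divisor cannot vanish. This is applied to the universal member of the system, whose coefficients are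
parameters (`exists_polynomialFunction_nondegenerate`).

For the divergence, `t` must not be identically zero. If it vanished for all sections, `D` would be
linearly equivalent to `K_X` and `TX(D)` would be `Ω¹`, which has no nonzero global section on a
complete toric surface (`exists_divergence_ne_zero`). -/

section

open MvPolynomial

/-! ### Elimination for `n` polynomials in `n` variables -/

/-- The chain rule for a polynomial whose coefficients are polynomial expressions. -/
theorem pderiv_eval₂_aeval {R σ : Type*} [CommRing R] [Fintype σ]
    (G : σ → MvPolynomial σ R) (q : MvPolynomial σ R) (k : σ) (P : Polynomial (MvPolynomial σ R)) :
    pderiv k (P.eval₂ (aeval G : _ →ₐ[R] MvPolynomial σ R).toRingHom q) =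
      P.derivative.eval₂ (aeval G : _ →ₐ[R] MvPolynomial σ R).toRingHom q * pderiv k q +
      ∑ l, (P.sum fun n a => aeval G (pderiv l a) * q ^ n) * pderiv k (G l) := by
  have chain : ∀ a : MvPolynomial σ R,
      pderiv k (aeval G a) = ∑ l, aeval G (pderiv l a) * pderiv k (G l) := by
    classical
    intro a
    induction a using MvPolynomial.induction_on with
    | C r => simp
    | add p q hp hq => simp only [map_add, hp, hq, add_mul, Finset.sum_add_distrib]
    | mul_X p i hp =>
      simp only [map_mul, aeval_X, Derivation.leibniz, hp, smul_eq_mul, map_add, pderiv_X, add_mul,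
        Finset.sum_add_distrib]
      congr 1
      · rw [Finset.sum_eq_single i]
        · simp
        · intro b _ hb; simp [hb.symm]
        · simp
      · rw [Finset.mul_sum]
        exact Finset.sum_congr rfl fun l _ => by ring
  induction P using Polynomial.induction_on' with
  | add p r hp hr =>
    have : ∀ l, ((p + r).sum fun n a => aeval G (pderiv l a) * q ^ n) =
        (p.sum fun n a => aeval G (pderiv l a) * q ^ n) +
        (r.sum fun n a => aeval G (pderiv l a) * q ^ n) := fun l =>
      Polynomial.sum_add_index _ _ _ (by simp) (by intros; simp [add_mul])
    simp only [Polynomial.eval₂_add, map_add, hp, hr, this, add_mul, Finset.sum_add_distrib]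
    ring
  | monomial n a =>
    have : ∀ l, ((Polynomial.monomial n a).sum fun n a => aeval G (pderiv l a) * q ^ n) =
        aeval G (pderiv l a) * q ^ n := fun l =>
      Polynomial.sum_monomial_index _ _ (by simp)
    simp only [this, Polynomial.eval₂_monomial, Polynomial.derivative_monomial,
      Derivation.leibniz, smul_eq_mul, Derivation.leibniz_pow, AlgHom.toRingHom_eq_coe,
      RingHom.coe_coe, chain, Finset.mul_sum, map_mul, map_natCast, nsmul_eq_mul]
    congr 1
    · ring
    · exact Finset.sum_congr rfl fun l _ => by ring

section Elimination

variable {R σ : Type*} [CommRing R] [IsDomain R] [Finite σ]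

/-- The polynomial ring has transcendence degree the number of variables, so an independent family
of that size is already a transcendence basis. -/
theorem isAlgebraic_of_algebraicIndependent_mvPolynomial {G : σ → MvPolynomial σ R}
    (hG : AlgebraicIndependent R G) (q : MvPolynomial σ R) :
    IsAlgebraic (Algebra.adjoin R (Set.range G)) q := by
  have hB := hG.isTranscendenceBasis_of_lift_trdeg_le_of_finite (by
    rw [MvPolynomial.trdeg_of_isDomain]; simp)
  exact hB.isAlgebraic.isAlgebraic q

/-- A polynomial in `n` variables divides a nonzero polynomial expression in `n` given
polynomials. -/
theorem exists_dvd_aeval {t : MvPolynomial σ R} (ht : t ≠ 0) (G : σ → MvPolynomial σ R) :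
    ∃ h : MvPolynomial σ R, h ≠ 0 ∧ t ∣ aeval G h := by
  by_cases hG : AlgebraicIndependent R G
  -- An algebraic nonzero element of a domain divides a nonzero element of the base ring, here
  -- `R[G]`.
  · obtain ⟨r, hr, hd⟩ := (isAlgebraic_of_algebraicIndependent_mvPolynomial hG t).exists_nonzero_dvd
      (mem_nonZeroDivisors_of_ne_zero ht)
    obtain ⟨r, hrm⟩ := r
    have hrm' := hrm
    rw [Algebra.adjoin_range_eq_range_aeval] at hrm'
    obtain ⟨h, rfl⟩ := hrm'
    refine ⟨h, ?_, hd⟩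
    rintro rfl
    exact hr (Subtype.ext (by simp))
  -- A nontrivial relation `h(G) = 0` serves for every `t`.
  · rw [algebraicIndependent_iff] at hG
    push Not at hG
    obtain ⟨h, h0, hne⟩ := hG
    exact ⟨h, hne, h0 ▸ dvd_zero t⟩

/-- In characteristic zero, a polynomial is a simple root of a polynomial whose coefficients are
expressions in given algebraically independent polynomials. -/
theorem exists_simple_root [CharZero R] {G : σ → MvPolynomial σ R}
    (hG : AlgebraicIndependent R G) (q : MvPolynomial σ R) :
    ∃ P : Polynomial (MvPolynomial σ R),
      P.eval₂ (aeval G : _ →ₐ[R] MvPolynomial σ R).toRingHom q = 0 ∧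
      P.derivative.eval₂ (aeval G : _ →ₐ[R] MvPolynomial σ R).toRingHom q ≠ 0 := by
  set φ := (aeval G : MvPolynomial σ R →ₐ[R] MvPolynomial σ R).toRingHom with hφ
  have hinj : Function.Injective φ := hG
  have hex : ∃ n, ∃ P : Polynomial (MvPolynomial σ R), P ≠ 0 ∧ P.eval₂ φ q = 0 ∧
      P.natDegree = n := by
    obtain ⟨P, hP, hP0⟩ := isAlgebraic_of_algebraicIndependent_mvPolynomial hG q
    have hr : (algebraMap (Algebra.adjoin R (Set.range G)) (MvPolynomial σ R)) =
      φ.comp (hG.aevalEquiv.symm : _ →ₐ[R] MvPolynomial σ R).toRingHom := by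
      ext1 x
      obtain ⟨y, rfl⟩ := hG.aevalEquiv.surjective x
      simp [hφ]
    refine ⟨_, P.map (hG.aevalEquiv.symm : _ →ₐ[R] MvPolynomial σ R).toRingHom, ?_, ?_, rfl⟩
    · rwa [Ne, Polynomial.map_eq_zero_iff]
      exact hG.aevalEquiv.symm.injective
    · rw [Polynomial.eval₂_map, ← hr]
      exact hP0
  classical
  -- For an annihilating polynomial of least degree, the derivative cannot annihilate `q`: its
  -- degree is smaller and, in characteristic zero, it is nonzero unless `P` is constant. A nonzero
  -- constant does not annihilate `q`, since substitution of `G` is injective.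
  obtain ⟨P, hP, hP0, hPn⟩ := Nat.find_spec hex
  refine ⟨P, hP0, fun h0 => ?_⟩
  by_cases hd : P.natDegree = 0
  · rw [Polynomial.eq_C_of_natDegree_eq_zero hd, Polynomial.eval₂_C, map_eq_zero_iff _ hinj] at hP0
    apply hP
    rw [Polynomial.eq_C_of_natDegree_eq_zero hd, hP0, map_zero]
  · refine Nat.find_min hex (m := P.derivative.natDegree) ?_ ⟨_, ?_, h0, rfl⟩
    · rw [← hPn]
      exact Polynomial.natDegree_derivative_lt hd
    · intro h
      exact hd (Polynomial.derivative_eq_zero.1 h)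

/-- The critical values of a polynomial map lie on a hypersurface: the Jacobian determinant divides
a nonzero polynomial expression in the components. -/
theorem exists_jacobian_dvd_aeval [Fintype σ] [DecidableEq σ] [CharZero R]
    (G : σ → MvPolynomial σ R) :
    ∃ h : MvPolynomial σ R, h ≠ 0 ∧
      (Matrix.of fun i k => pderiv k (G i)).det ∣ aeval G h := by
  by_cases hG : AlgebraicIndependent R G
  · choose P hP hP' using fun i => exists_simple_root hG (X i)
    set φ := (aeval G : MvPolynomial σ R →ₐ[R] MvPolynomial σ R).toRingHom with hφ
    set M : Matrix σ σ (MvPolynomial σ R) := Matrix.of fun i l =>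
      (P i).sum fun n a => aeval G (pderiv l a) * (X i) ^ n with hM
    -- Differentiating `P i (G, X i) = 0` with respect to `X k`; simplicity of the roots makes the
    -- diagonal entries nonzero.
    have key : M * (Matrix.of fun i k => pderiv k (G i)) =
        Matrix.diagonal fun i => - (P i).derivative.eval₂ φ (X i) := by
      ext1 i k
      have h := pderiv_eval₂_aeval G (X i) k (P i)
      rw [hP i, map_zero] at h
      rw [Matrix.mul_apply, Matrix.diagonal_apply]
      rw [pderiv_X] at h
      simp only [hM, Matrix.of_apply]
      rw [eq_neg_of_add_eq_zero_right h.symm, Pi.single_apply]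
      split_ifs <;> simp [hφ]
    have hdet := congrArg Matrix.det key
    rw [Matrix.det_mul, Matrix.det_diagonal] at hdet
    obtain ⟨h, h0, hd⟩ := exists_dvd_aeval (t := ∏ i, - (P i).derivative.eval₂ φ (X i))
      (Finset.prod_ne_zero_iff.2 fun i _ => neg_ne_zero.2 (hP' i)) G
    exact ⟨h, h0, (Dvd.intro_left _ hdet).trans hd⟩
  · rw [algebraicIndependent_iff] at hG
    push Not at hG
    obtain ⟨h, h0, hne⟩ := hG
    exact ⟨h, hne, h0 ▸ dvd_zero _⟩

end Elimination

/-! ### General members of a linear system of polynomial vector fields -/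

section Generic

open ToricSurface

theorem eval_add_mem_polynomialFunctions {W ι : Type*} [AddCommGroup W] [Module ℂ W]
    (φ : ι → Module.Dual ℂ W) (s : ι → ℂ) (H : MvPolynomial ι ℂ) :
    (fun Y => eval (fun i => φ i Y + s i) H) ∈ polynomialFunctions W := by
  induction H using MvPolynomial.induction_on with
  | C a =>
    simp only [eval_C]
    exact (polynomialFunctions W).algebraMap_mem a
  | add p q hp hq =>
    simp only [map_add]
    exact (polynomialFunctions W).add_mem hp hq
  | mul_X p i hp =>
    simp only [map_mul, eval_X]
    exact (polynomialFunctions W).mul_mem hp ((polynomialFunctions W).add_mem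
      (Algebra.subset_adjoin ⟨φ i, rfl⟩) ((polynomialFunctions W).algebraMap_mem (s i)))

theorem exists_eval_map_ne_zero {ι σ : Type*} {h : MvPolynomial σ (MvPolynomial ι ℂ)}
    (h0 : h ≠ 0) : ∃ (c : ι → ℂ) (u : σ → ℂ), eval u (map (eval c) h) ≠ 0 := by
  by_contra! H
  refine h0 (MvPolynomial.ext _ _ fun e => MvPolynomial.funext fun c => ?_)
  have : map (eval c) h = 0 := MvPolynomial.funext fun u => by rw [H, map_zero]
  have := congrArg (coeff e) this
  simpa [coeff_map] using this

theorem eval_map_eval {ι σ : Type*} (c : ι → ℂ) (u : σ → ℂ)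
    (h : MvPolynomial σ (MvPolynomial ι ℂ)) :
    eval u (map (eval c) h) = eval c (eval (fun i => C (u i)) h) := by
  induction h using MvPolynomial.induction_on with
  | C a => simp
  | add p q hp hq => simp only [map_add, hp, hq]
  | mul_X p i hp => simp [hp]

theorem eval_map_aeval {R σ : Type*} [CommRing R] (φ : R →+* ℂ) (q : σ → ℂ)
    (G : σ → MvPolynomial σ R) (h : MvPolynomial σ R) :
    eval q (map φ (aeval G h)) = eval (fun i => eval q (map φ (G i))) (map φ h) := by
  induction h using MvPolynomial.induction_on with
  | C a => simp
  | add p q hp hq => simp only [map_add, hp, hq]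
  | mul_X p i hp => simp only [map_mul, hp, aeval_X, map_X, eval_X]

/-- A linear system of polynomial vector fields on affine space that contains the constant vector
fields and a vector field with nonzero divergence: the zeros of its general member are
nondegenerate, and the divergence does not vanish at them. -/
theorem exists_polynomialFunction_nondegenerate {σ W : Type*} [Fintype σ] [DecidableEq σ]
    [AddCommGroup W] [Module ℂ W] [FiniteDimensional ℂ W] (p : σ → W →ₗ[ℂ] MvPolynomial σ ℂ)
    (w : σ → W) (hw : ∀ i j, p i (w j) = if i = j then 1 else 0)
    (hdiv : ∃ Y, ∑ i, pderiv i (p i Y) ≠ 0) :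
    ∃ f ∈ polynomialFunctions W, (∃ Y, f Y ≠ 0) ∧ ∀ Y, f Y ≠ 0 → ∀ q : σ → ℂ,
      (∀ i, eval q (p i Y) = 0) →
      eval q (Matrix.of fun i k => pderiv k (p i Y)).det ≠ 0 ∧
      eval q (∑ i, pderiv i (p i Y)) ≠ 0 := by
  set b := Module.finBasis ℂ W with hb
  -- The universal member of the system: its coordinates in the basis `b` are new variables in the
  -- coefficient ring.
  set G : σ → MvPolynomial σ (MvPolynomial (Fin (Module.finrank ℂ W)) ℂ) := fun i =>
    ∑ k, C (X k) * map C (p i (b k)) with hG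
  have hspec : ∀ Y i, map (eval (b.repr Y)) (G i) = p i Y := by
    intro Y i
    conv_rhs => rw [← b.sum_repr Y, map_sum]
    rw [hG, map_sum]
    refine Finset.sum_congr rfl fun k _ => ?_
    have hc : (eval (b.repr Y)).comp (C : ℂ →+* _) = RingHom.id ℂ := by ext; simp
    rw [map_mul, map_C, eval_X, map_map, hc, map_id, map_smul, smul_eq_C_mul]
  have hjac : ∀ Y, map (eval (b.repr Y)) (Matrix.of fun i k => pderiv k (G i)).det =
      (Matrix.of fun i k => pderiv k (p i Y)).det := by
    intro Y
    rw [RingHom.map_det]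
    congr 1
    ext1 i k
    simp only [RingHom.mapMatrix_apply, Matrix.map_apply, Matrix.of_apply]
    rw [← pderiv_map, hspec]
  have htr : ∀ Y, map (eval (b.repr Y)) (∑ i, pderiv i (G i)) = ∑ i, pderiv i (p i Y) := by
    intro Y
    rw [map_sum]
    exact Finset.sum_congr rfl fun i _ => by rw [← pderiv_map, hspec]
  have ht : ∑ i, pderiv i (G i) ≠ 0 := by
    obtain ⟨Y, hY⟩ := hdiv
    intro h
    rw [← htr, h, map_zero] at hY
    exact hY rfl
  obtain ⟨h₁, h₁0, hd₁⟩ := exists_jacobian_dvd_aeval G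
  obtain ⟨h₂, h₂0, hd₂⟩ := exists_dvd_aeval ht G
  obtain ⟨c, u, hcu⟩ := exists_eval_map_ne_zero (mul_ne_zero h₁0 h₂0)
  set v : W := ∑ i, u i • w i with hv
  have hpv : ∀ i, p i v = C (u i) := by
    intro i
    rw [hv, map_sum]
    simp only [map_smul, hw, smul_ite, smul_zero]
    rw [Finset.sum_ite_eq]
    simp [smul_eq_C_mul]
  have hpd : ∀ Y i k, pderiv k (p i (Y + v)) = pderiv k (p i Y) := by
    intro Y i k
    rw [map_add, map_add, hpv, pderiv_C, add_zero]
  -- The constant field `v` has components `u`, so the zeros of `Y` are the points where `Y + v`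
  -- takes the value `u`, and both fields have the same derivatives. The function is therefore
  -- evaluated at `Y + v`, with `u` substituted for the variables of `h₁ * h₂`.
  refine ⟨fun Y => eval (b.repr (Y + v)) (eval (fun i => C (u i)) (h₁ * h₂)), ?_, ?_, ?_⟩
  · have := eval_add_mem_polynomialFunctions (fun k => b.coord k) (b.repr v)
      (eval (fun i => C (u i)) (h₁ * h₂))
    simp only [Module.Basis.coord_apply, ← Finsupp.add_apply, ← map_add] at this
    exact this
  · refine ⟨b.repr.symm (Finsupp.equivFunOnFinite.symm c) - v, ?_⟩
    rw [eval_map_eval] at hcu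
    simpa using hcu
  · intro Y hY q hq
    beta_reduce at hY
    rw [← eval_map_eval, map_mul, map_mul] at hY
    have hGq : (fun i => eval q (map (eval (b.repr (Y + v))) (G i))) = u := by
      funext i
      rw [hspec, map_add, map_add, hq, hpv, eval_C, zero_add]
    have hmain : ∀ (t h : MvPolynomial σ (MvPolynomial (Fin (Module.finrank ℂ W)) ℂ)),
        t ∣ aeval G h → eval u (map (eval (b.repr (Y + v))) h) ≠ 0 →
        eval q (map (eval (b.repr (Y + v))) t) ≠ 0 := by
      rintro t h ⟨r, hr⟩ hne h0
      have := eval_map_aeval (eval (b.repr (Y + v))) q G h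
      rw [hGq, hr, map_mul, map_mul, h0, zero_mul] at this
      exact hne this.symm
    constructor
    · have := hmain _ _ hd₁ (left_ne_zero_of_mul hY)
      rw [hjac] at this
      simpa only [hpd] using this
    · have := hmain _ _ hd₂ (right_ne_zero_of_mul hY)
      rw [htr] at this
      simpa only [hpd] using this

end Generic

/-! ### The Jacobian criterion for radical ideals -/

section Radical

/-- By the Nullstellensatz, `f` and `j` generate the unit ideal because they have no common zero. -/
theorem isUnit_mk_of_forall_eval_ne_zero {σ : Type*} [Finite σ]
    (f : σ → MvPolynomial σ ℂ) (j : MvPolynomial σ ℂ)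
    (h : ∀ q : σ → ℂ, (∀ i, eval q (f i) = 0) → eval q j ≠ 0) :
    IsUnit (Ideal.Quotient.mk (Ideal.span (Set.range f)) j) := by
  have htop : Ideal.span (Set.range f) ⊔ Ideal.span {j} = ⊤ := by
    rw [← Ideal.radical_eq_top, ← vanishingIdeal_zeroLocus_eq_radical (K := ℂ),
      Ideal.eq_top_iff_one]
    intro q hq
    exfalso
    have hq' : ∀ r ∈ Ideal.span (Set.range f) ⊔ Ideal.span {j}, eval q r = 0 := fun r hr => hq r hr
    exact h q (fun i => hq' _ (Ideal.mem_sup_left (Ideal.subset_span ⟨i, rfl⟩)))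
      (hq' _ (Ideal.mem_sup_right (Ideal.mem_span_singleton_self j)))
  obtain ⟨a, ha, r, hr, hsum⟩ :=
    Submodule.mem_sup.1 (htop ▸ Submodule.mem_top : (1 : MvPolynomial σ ℂ) ∈ _)
  obtain ⟨s, rfl⟩ := Ideal.mem_span_singleton.1 hr
  refine IsUnit.of_mul_eq_one (Ideal.Quotient.mk _ s) ?_
  rw [← map_mul, ← map_one (Ideal.Quotient.mk _), ← hsum, map_add,
    Ideal.Quotient.eq_zero_iff_mem.2 ha, zero_add]

/-- A system of `n` polynomial equations in `n` unknowns all of whose solutions are nondegenerate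
generates a radical ideal. -/
theorem isRadical_span_of_jacobian_ne_zero {σ : Type*} [Fintype σ] [DecidableEq σ]
    (f : σ → MvPolynomial σ ℂ)
    (h : ∀ q : σ → ℂ, (∀ i, eval q (f i) = 0) →
      eval q (Matrix.of fun i k => pderiv k (f i)).det ≠ 0) :
    (Ideal.span (Set.range f)).IsRadical := by
  set I := Ideal.span (Set.range f) with hI
  set Q := MvPolynomial σ ℂ ⧸ I
  have hu := isUnit_mk_of_forall_eval_ne_zero f _ h
  rw [← hI] at hu
  let D : Derivation ℂ (MvPolynomial σ ℂ) (Ω[Q⁄ℂ]) :=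
    (KaehlerDifferential.D ℂ Q).compAlgebraMap (MvPolynomial σ ℂ)
  have hD : ∀ r, D r = KaehlerDifferential.D ℂ Q (Ideal.Quotient.mk I r) := fun r => rfl
  have hsum : ∀ r, D r = ∑ k, pderiv k r • D (X k) := by
    intro r
    have hcoe : ∀ (E : σ → Derivation ℂ (MvPolynomial σ ℂ) (Ω[Q⁄ℂ])) x, (∑ k, E k) x = ∑ k, E k x :=
      fun E x => by
        have := congrFun (map_sum Derivation.coeFnAddMonoidHom E Finset.univ) x
        rwa [Finset.sum_apply] at this
    have : D = ∑ k,
        (LinearMap.toSpanSingleton (MvPolynomial σ ℂ) _ (D (X k))).compDer (pderiv k) := by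
      refine derivation_ext fun i => ?_
      rw [hcoe, Finset.sum_eq_single i]
      · simp
      · intro k _ hk; simp [pderiv_X, hk.symm]
      · simp
    conv_lhs => rw [this]
    rw [hcoe]
    rfl
  have h0 : ∀ i, ∑ k, pderiv k (f i) • D (X k) = 0 := by
    intro i
    rw [← hsum, hD, Ideal.Quotient.eq_zero_iff_mem.2 (Ideal.subset_span (Set.mem_range_self i)),
      map_zero]
  -- The relations `h0` form a linear system in the differentials `D (X k)`. Multiplying by the
  -- adjugate leaves the determinant, a unit modulo `I`. Hence the Kähler differentials vanish, and
  -- the quotient is unramified over a field, so reduced.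
  have hX : ∀ k, D (X k) = 0 := by
    intro k
    set M : Matrix σ σ (MvPolynomial σ ℂ) := Matrix.of fun i k => pderiv k (f i) with hM
    have hdet : M.det • D (X k) = 0 := by
      have : ∑ i, M.adjugate k i • ∑ l, M i l • D (X l) = M.det • D (X k) := by
        simp only [Finset.smul_sum, smul_smul]
        rw [Finset.sum_comm]
        simp only [← Finset.sum_smul, ← Matrix.mul_apply, Matrix.adjugate_mul]
        simp [Matrix.one_apply, ite_smul]
      rw [← this]
      exact Finset.sum_eq_zero fun i _ => by rw [show ∑ l, M i l • D (X l) = 0 from h0 i, smul_zero]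
    have h2 : Ideal.Quotient.mk I M.det • D (X k) = 0 := hdet
    exact hu.smul_eq_zero.1 h2
  have hD0 : ∀ x : Q, KaehlerDifferential.D ℂ Q x = 0 := by
    intro x
    obtain ⟨r, rfl⟩ := Ideal.Quotient.mk_surjective x
    rw [← hD, hsum]
    exact Finset.sum_eq_zero fun k _ => by rw [hX, smul_zero]
  have hsub : Subsingleton (Ω[Q⁄ℂ]) := by
    have hspan := KaehlerDifferential.span_range_derivation ℂ Q
    rw [Submodule.span_eq_bot.2] at hspan
    · exact (Submodule.subsingleton_iff Q).1 (subsingleton_of_bot_eq_top hspan)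
    · rintro _ ⟨x, rfl⟩
      exact hD0 x
  have hunr : Algebra.FormallyUnramified ℂ Q := ⟨hsub⟩
  have : IsReduced Q := Algebra.FormallyUnramified.isReduced_of_field ℂ Q
  exact (Ideal.isRadical_iff_quotient_reduced I).2 this

end Radical

end

noncomputable section

open MvPolynomial

namespace ToricSurface

/-! ### The pairing and smooth two-dimensional charts -/

lemma pairing_sub (m m' v : Lattice) : pairing (m - m') v = pairing m v - pairing m' v := by
  simp only [pairing, Pi.sub_apply]; ring

lemma pairing_smul (k : ℤ) (m v : Lattice) : pairing (k • m) v = k * pairing m v := by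
  simp only [pairing, Pi.smul_apply, smul_eq_mul]; ring

lemma pairing_sum {ι : Type*} (s : Finset ι) (m : ι → Lattice) (v : Lattice) :
    pairing (∑ i ∈ s, m i) v = ∑ i ∈ s, pairing (m i) v := by
  simp only [pairing, Finset.sum_apply, Finset.sum_mul, Finset.sum_add_distrib]

/-- A two-dimensional cone of the fan with a numbering of its rays and the dual basis of the lattice
of characters. -/
structure SmoothChart (F : SmoothCompleteFan) where
  ray : Fin 2 → Ray F
  dual : Fin 2 → Lattice
  pairing_dual : ∀ i j, pairing (dual i) (ray j).1 = if i = j then 1 else 0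
  mem_cones : (Finset.univ.image fun i => (ray i).1) ∈ F.cones

namespace SmoothChart

variable {F : SmoothCompleteFan} (C : SmoothChart F)

/-- The underlying cone of a chart. -/
def cone : Finset Lattice := Finset.univ.image fun i => (C.ray i).1

lemma cone_mem : C.cone ∈ F.cones := C.mem_cones

lemma mem_cone {v : Lattice} : v ∈ C.cone ↔ ∃ i, (C.ray i).1 = v := by
  simp [cone]

lemma ray_mem_cone (i : Fin 2) : (C.ray i).1 ∈ C.cone := C.mem_cone.2 ⟨i, rfl⟩

/-- Duality makes the product of the determinants of `ray` and `dual` equal to `1`, so Cramer's rule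
applies over `ℤ`. -/
lemma eq_zero_of_pairing {m : Lattice} (h : ∀ i, pairing m (C.ray i).1 = 0) : m = 0 := by
  have h0 := h 0
  have h1 := h 1
  have e00 := C.pairing_dual 0 0
  have e01 := C.pairing_dual 0 1
  have e10 := C.pairing_dual 1 0
  have e11 := C.pairing_dual 1 1
  simp only [pairing, if_true, Fin.isValue, zero_ne_one, one_ne_zero, if_false] at *
  set r := (C.ray 0).1
  set s := (C.ray 1).1
  set d := C.dual 0
  set e := C.dual 1
  have hdet : (r 0 * s 1 - r 1 * s 0) * (d 0 * e 1 - d 1 * e 0) = 1 := by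
    linear_combination (e 0 * s 0 + e 1 * s 1) * e00 + e11 - (e 0 * r 0 + e 1 * r 1) * e01
  funext i
  fin_cases i
  · change m 0 = 0
    linear_combination (-m 0) * hdet + (d 0 * e 1 - d 1 * e 0) * (s 1 * h0 - r 1 * h1)
  · change m 1 = 0
    linear_combination (-m 1) * hdet + (d 0 * e 1 - d 1 * e 0) * (r 0 * h1 - s 0 * h0)

lemma eq_sum_pairing (m : Lattice) : m = ∑ i, pairing m (C.ray i).1 • C.dual i := by
  rw [← sub_eq_zero]
  refine C.eq_zero_of_pairing fun j => ?_
  rw [pairing_sub, pairing_sum]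
  simp only [pairing_smul, C.pairing_dual]
  simp

lemma pairing_eq_sum (m v : Lattice) :
    pairing m v = ∑ i, pairing m (C.ray i).1 * pairing (C.dual i) v := by
  conv_lhs => rw [C.eq_sum_pairing m, pairing_sum]
  simp only [pairing_smul]

lemma ray_ne {i j : Fin 2} (h : i ≠ j) : C.ray i ≠ C.ray j := by
  intro he
  have h1 := C.pairing_dual i i
  rw [he, C.pairing_dual] at h1
  simp [h] at h1

end SmoothChart

/-! ### Combinatorics of complete fans -/

lemma sum_mul_of_mem_realCone {σ : Finset Lattice} {x : Fin 2 → ℝ} (hx : x ∈ realCone σ)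
    {m : Lattice} (hm : ∀ v ∈ σ, 0 ≤ pairing m v) : 0 ≤ m 0 * x 0 + m 1 * x 1 := by
  obtain ⟨c, hc, rfl⟩ := hx
  have : (m 0 : ℝ) * (∑ v ∈ σ, c v • fun i => (v i : ℝ)) 0 +
      m 1 * (∑ v ∈ σ, c v • fun i => (v i : ℝ)) 1 = ∑ v ∈ σ, c v * (pairing m v : ℝ) := by
    simp only [Finset.sum_apply, Pi.smul_apply, smul_eq_mul, Finset.mul_sum, pairing,
      ← Finset.sum_add_distrib]
    exact Finset.sum_congr rfl fun v _ => by push_cast; ring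
  rw [this]
  exact Finset.sum_nonneg fun v hv => mul_nonneg (hc v) (by exact_mod_cast hm v hv)

variable (F : SmoothCompleteFan)

lemma singleton_mem_cones {F : SmoothCompleteFan} {σ : Finset Lattice} (hσ : σ ∈ F.cones)
    {v : Lattice} (hv : v ∈ σ) : {v} ∈ F.cones :=
  F.face σ hσ _ (Finset.singleton_subset_iff.2 hv)

/-- The rays of a complete fan do not lie in a half plane. -/
lemma eq_zero_of_pairing_nonneg {m : Lattice} (hm : ∀ ρ : Ray F, 0 ≤ pairing m ρ.1) : m = 0 := by
  -- Completeness puts `-m` in a cone, on which `m` is nonnegative; this gives `-|m|² ≥ 0`.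
  obtain ⟨σ, hσ, hx⟩ := F.complete fun i => -(m i : ℝ)
  have h := sum_mul_of_mem_realCone hx (m := m)
    fun v hv => hm ⟨v, singleton_mem_cones hσ hv⟩
  have h0 : (m 0 : ℝ) = 0 := by nlinarith [sq_nonneg (m 0 : ℝ), sq_nonneg (m 1 : ℝ)]
  have h1 : (m 1 : ℝ) = 0 := by nlinarith [sq_nonneg (m 0 : ℝ), sq_nonneg (m 1 : ℝ)]
  funext i
  fin_cases i
  · exact_mod_cast h0
  · exact_mod_cast h1

/-- The polytope of a divisor on a complete toric surface contains finitely many characters. -/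
lemma finite_setOf_le_pairing (D : Ray F → ℤ) :
    {m : Lattice | ∀ ρ : Ray F, D ρ ≤ pairing m ρ.1}.Finite := by
  have bound : ∀ x : Fin 2 → ℝ, ∃ B : ℝ, ∀ m : Lattice, (∀ ρ : Ray F, D ρ ≤ pairing m ρ.1) →
      B ≤ m 0 * x 0 + m 1 * x 1 := by
    intro x
    obtain ⟨σ, hσ, c, hc, rfl⟩ := F.complete x
    -- The default `0` is never reached: every generator of a cone of the fan is a ray.
    refine ⟨∑ v ∈ σ, c v * (if h : {v} ∈ F.cones then D ⟨v, h⟩ else 0 : ℤ), fun m hm => ?_⟩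
    have : (m 0 : ℝ) * (∑ v ∈ σ, c v • fun i => (v i : ℝ)) 0 +
        m 1 * (∑ v ∈ σ, c v • fun i => (v i : ℝ)) 1 = ∑ v ∈ σ, c v * (pairing m v : ℝ) := by
      simp only [Finset.sum_apply, Pi.smul_apply, smul_eq_mul, Finset.mul_sum, pairing,
        ← Finset.sum_add_distrib]
      exact Finset.sum_congr rfl fun v _ => by push_cast; ring
    rw [this]
    refine Finset.sum_le_sum fun v hv => mul_le_mul_of_nonneg_left ?_ (hc v)
    rw [dif_pos (singleton_mem_cones hσ hv)]
    exact_mod_cast hm ⟨v, singleton_mem_cones hσ hv⟩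
  obtain ⟨a, ha⟩ := bound ![1, 0]
  obtain ⟨b, hb⟩ := bound ![-1, 0]
  obtain ⟨c, hc⟩ := bound ![0, 1]
  obtain ⟨d, hd⟩ := bound ![0, -1]
  refine (Set.finite_Icc (![⌊a⌋, ⌊c⌋] : Lattice) ![⌈-b⌉, ⌈-d⌉]).subset fun m hm => ?_
  have ha := ha m hm
  have hb := hb m hm
  have hc := hc m hm
  have hd := hd m hm
  simp only [Matrix.cons_val_zero, Matrix.cons_val_one, mul_one, mul_zero, add_zero, zero_add,
    mul_neg] at ha hb hc hd
  refine ⟨fun i => ?_, fun i => ?_⟩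
  · fin_cases i
    · exact_mod_cast (Int.floor_le a).trans ha
    · exact_mod_cast (Int.floor_le c).trans hc
  · fin_cases i
    · exact_mod_cast (show (m 0 : ℝ) ≤ -b by linarith).trans (Int.le_ceil (-b))
    · exact_mod_cast (show (m 1 : ℝ) ≤ -d by linarith).trans (Int.le_ceil (-d))

variable {F}

/-- A lattice basis has two elements, so a cone with at least two generators uses all of it, and the
coordinate functionals give the dual basis. -/
lemma exists_smoothChart_of_two_le_card {σ : Finset Lattice} (hσ : σ ∈ F.cones)
    (h2 : 2 ≤ σ.card) : ∃ C : SmoothChart F, C.cone = σ := by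
  classical
  obtain ⟨b, hb⟩ := F.smooth σ hσ
  have hσb : σ = Finset.univ.image b := by
    refine Finset.eq_of_subset_of_card_le (fun v hv => ?_) ?_
    · obtain ⟨i, rfl⟩ := hb hv
      exact Finset.mem_image_of_mem _ (Finset.mem_univ i)
    · exact Finset.card_image_le.trans (by simpa using h2)
  have hmem : ∀ i, b i ∈ σ := fun i => hσb ▸ Finset.mem_image_of_mem _ (Finset.mem_univ i)
  refine ⟨⟨fun i => ⟨b i, singleton_mem_cones hσ (hmem i)⟩,
    fun i => ![b.coord i ![1, 0], b.coord i ![0, 1]], fun i j => ?_, ?_⟩, ?_⟩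
  · have h1 : b.coord i (b j) = if i = j then 1 else 0 := by
      simp [Finsupp.single_apply, eq_comm]
    have h2 : b j = b j 0 • ![1, 0] + b j 1 • ![0, 1] := by
      funext i; fin_cases i <;> simp
    rw [← h1]
    conv_rhs => rw [h2, map_add, map_smul, map_smul]
    simp only [pairing, Matrix.cons_val_zero, Matrix.cons_val_one, smul_eq_mul]
    ring
  · rwa [← hσb]
  · exact hσb.symm

lemma SmoothChart.mem_realCone (C : SmoothChart F) {v : Lattice}
    (h : ∀ i, 0 ≤ pairing (C.dual i) v) : (fun i => (v i : ℝ)) ∈ realCone C.cone := by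
  classical
  refine ⟨fun u => ∑ i, if (C.ray i).1 = u then (pairing (C.dual i) v : ℝ) else 0, fun u =>
    Finset.sum_nonneg fun i _ => ?_, ?_⟩
  · split_ifs
    · exact_mod_cast h i
    · exact le_rfl
  · have hinj : Set.InjOn (fun i => (C.ray i).1) (Finset.univ : Finset (Fin 2)) := by
      intro i _ j _ hij
      by_contra hne
      exact C.ray_ne hne (Subtype.ext hij)
    have hc : ∀ i, (∑ j, if (C.ray j).1 = (C.ray i).1 then (pairing (C.dual j) v : ℝ) else 0) =
        pairing (C.dual i) v := by
      intro i
      rw [Finset.sum_eq_single i]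
      · simp
      · intro j _ hj
        rw [if_neg fun h => C.ray_ne hj (Subtype.ext h)]
      · simp
    rw [SmoothChart.cone, Finset.sum_image hinj]
    simp only [hc]
    have hv : ∀ k, v k = ∑ i, pairing (C.dual i) v * (C.ray i).1 k := by
      intro k
      have := C.pairing_eq_sum (Pi.single k 1) v
      fin_cases k <;> simpa [pairing, mul_comm] using this
    funext k
    rw [hv k]
    simp

lemma ne_zero_of_singleton_mem_cones {v : Lattice} (hv : {v} ∈ F.cones) : v ≠ 0 := by
  rintro rfl
  obtain ⟨b, hb⟩ := F.smooth _ hv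
  obtain ⟨i, hi⟩ := hb (by simp : (0 : Lattice) ∈ (({0} : Finset Lattice) : Set Lattice))
  exact b.ne_zero i hi

lemma det_eq_zero_of_mem_realCone {σ : Finset Lattice} (hσ : σ.card < 2) {x y : Fin 2 → ℝ}
    (hx : x ∈ realCone σ) (hy : y ∈ realCone σ) : x 0 * y 1 - x 1 * y 0 = 0 := by
  obtain ⟨c, -, rfl⟩ := hx
  obtain ⟨d, -, rfl⟩ := hy
  rcases Finset.card_le_one_iff_subset_singleton.1 (Nat.le_of_lt_succ hσ) with ⟨v, hv⟩
  rcases Finset.subset_singleton_iff.1 hv with rfl | rfl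
  · simp
  · simp
    ring

/-- Every ray of a complete fan in the plane is a face of a two-dimensional cone. -/
lemma exists_smoothChart_of_ray (ρ : Ray F) : ∃ C : SmoothChart F, ρ.1 ∈ C.cone := by
  classical
  set v := ρ.1 with hvdef
  have hv0 : v ≠ 0 := ne_zero_of_singleton_mem_cones ρ.2
  -- The points `n • v + w` approach the direction of `v` from one side. Infinitely many of them lie
  -- in one cone `σ`, which turns out to have `v` as a generator.
  set w : Lattice := ![-v 1, v 0] with hw
  choose s hs hx using fun n : ℕ => F.complete fun i => (((n • v + w : Lattice) i : ℤ) : ℝ)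
  obtain ⟨⟨σ, hσ⟩, hinf⟩ := Finite.exists_infinite_fiber fun n => (⟨s n, hs n⟩ : {σ // σ ∈ F.cones})
  rw [Set.infinite_coe_iff] at hinf
  have hmem : ∀ n ∈ (fun n => (⟨s n, hs n⟩ : {σ // σ ∈ F.cones})) ⁻¹' {⟨σ, hσ⟩},
      (fun i => (((n • v + w : Lattice) i : ℤ) : ℝ)) ∈ realCone σ := by
    intro n hn
    have : s n = σ := congrArg Subtype.val hn
    exact this ▸ hx n
  set S := (fun n => (⟨s n, hs n⟩ : {σ // σ ∈ F.cones})) ⁻¹' {⟨σ, hσ⟩}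
  have hcard : 2 ≤ σ.card := by
    by_contra! hlt
    obtain ⟨n, hn, -⟩ := hinf.exists_gt 0
    obtain ⟨k, hk, hnk⟩ := hinf.exists_gt n
    have h := det_eq_zero_of_mem_realCone hlt (hmem n hn) (hmem k hk)
    simp only [hw, Pi.add_apply, Pi.smul_apply, Matrix.cons_val_zero, Matrix.cons_val_one] at h
    have h' : (n * v 0 + -v 1) * (k * v 1 + v 0) - (n * v 1 + v 0) * (k * v 0 + -v 1) = 0 := by
      simpa using (by exact_mod_cast h : (n • v 0 + -v 1) * (k • v 1 + v 0) -
        (n • v 1 + v 0) * (k • v 0 + -v 1) = 0)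
    -- Two of these points would be linearly dependent in a cone of dimension at most one, but their
    -- determinant is `(n - k)|v|²`.
    have h2 : ((n : ℤ) - k) * (v 0 ^ 2 + v 1 ^ 2) = 0 := by linear_combination h'
    have hne : (n : ℤ) - k ≠ 0 := by omega
    have h3 := (mul_eq_zero.1 h2).resolve_left hne
    have h30 : v 0 = 0 := by nlinarith [sq_nonneg (v 0), sq_nonneg (v 1)]
    have h31 : v 1 = 0 := by nlinarith [sq_nonneg (v 0), sq_nonneg (v 1)]
    exact hv0 (funext fun i => by fin_cases i <;> assumption)
  obtain ⟨C, rfl⟩ := exists_smoothChart_of_two_le_card hσ hcard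
  refine ⟨C, ?_⟩
  -- A dual functional negative on `v` would be negative on `n • v + w` for large `n`.
  have hnn : ∀ i, 0 ≤ pairing (C.dual i) v := by
    intro i
    by_contra! hneg
    obtain ⟨n, hn, hgt⟩ := hinf.exists_gt (pairing (C.dual i) w).toNat
    have h := sum_mul_of_mem_realCone (hmem n hn) (m := C.dual i) (fun u hu => by
      obtain ⟨j, rfl⟩ := C.mem_cone.1 hu
      rw [C.pairing_dual]
      split_ifs <;> norm_num)
    have h' : 0 ≤ n * pairing (C.dual i) v + pairing (C.dual i) w := by
      have e : C.dual i 0 * (n • v + w : Lattice) 0 + C.dual i 1 * (n • v + w : Lattice) 1 =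
          n * pairing (C.dual i) v + pairing (C.dual i) w := by
        simp [pairing]; ring
      rw [← e]
      exact_mod_cast h
    have : (n : ℤ) * pairing (C.dual i) v ≤ n * (-1) :=
      mul_le_mul_of_nonneg_left (by omega) (by omega)
    omega
  have hboth : (fun i => (v i : ℝ)) ∈ realCone ({v} : Finset Lattice) ∩ realCone C.cone :=
    ⟨⟨fun _ => 1, fun _ => zero_le_one, by simp⟩, C.mem_realCone hnn⟩
  -- The two cones meet in the cone over their common generators; if `v` were not one of these, that
  -- cone would be `{0}`.
  rw [F.inter _ ρ.2 _ C.cone_mem] at hboth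
  by_contra hnot
  rw [Finset.singleton_inter_of_notMem hnot] at hboth
  obtain ⟨c, -, hc⟩ := hboth
  refine hv0 (funext fun i => ?_)
  simpa using congrFun hc i

variable (F) in
lemma nonempty_ray : Nonempty (Ray F) := by
  by_contra h
  rw [not_nonempty_iff] at h
  have := eq_zero_of_pairing_nonneg F (m := ![1, 0]) fun ρ => h.elim ρ
  simpa using congrFun this 0

/-- Every cone of a complete fan in the plane is a face of a two-dimensional cone. -/
lemma exists_smoothChart_of_mem_cones {τ : Finset Lattice} (hτ : τ ∈ F.cones) :
    ∃ C : SmoothChart F, τ ⊆ C.cone := by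
  by_cases h2 : 2 ≤ τ.card
  · obtain ⟨C, hC⟩ := exists_smoothChart_of_two_le_card hτ h2
    exact ⟨C, hC.ge⟩
  · obtain ⟨v, hv⟩ := Finset.card_le_one_iff_subset_singleton.1 (Nat.le_of_lt_succ (not_le.1 h2))
    rcases Finset.subset_singleton_iff.1 hv with rfl | rfl
    · obtain ⟨ρ⟩ := nonempty_ray F
      exact (exists_smoothChart_of_ray ρ).imp fun C _ => Finset.empty_subset _
    · exact (exists_smoothChart_of_ray ⟨v, hτ⟩).imp fun C hC => Finset.singleton_subset_iff.2 hC

/-! ### Vector fields on the torus -/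

lemma character_zero : character 0 = 1 := rfl

lemma coeff_character_mul (n k : Lattice) (f : TorusRing) :
    (character n * f).coeff k = f.coeff (k - n) := by
  rw [character, AddMonoidAlgebra.coeff_single_mul_eq_mul_coeff (m₂ := k - n), one_mul]
  intro a _
  constructor
  · rintro rfl; abel
  · rintro rfl; abel

lemma single_eq_smul_character (m : Lattice) (c : ℂ) :
    (AddMonoidAlgebra.single m c : TorusRing) = c • character m := by
  simp [character]

/-- The invariant vector field `χ^m ↦ ⟨m, u⟩ χ^m` of a one-parameter subgroup. -/
def invariantField (u : Lattice) : Derivation ℂ TorusRing TorusRing :=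
  Derivation.mk'
    ((Finsupp.linearCombination ℂ fun m : Lattice => (pairing m u : ℂ) • character m) ∘ₗ
      (AddMonoidAlgebra.coeffLinearEquiv ℂ).toLinearMap) (by
    have hs : ∀ m c, ((Finsupp.linearCombination ℂ fun m : Lattice =>
        (pairing m u : ℂ) • character m) ∘ₗ (AddMonoidAlgebra.coeffLinearEquiv ℂ).toLinearMap) (AddMonoidAlgebra.single m c) =
        c • (pairing m u : ℂ) • character m := fun m c => Finsupp.linearCombination_single ..
    intro a b
    induction a using AddMonoidAlgebra.induction_linear with
    | zero => simp
    | add f g hf hg => rw [add_mul, map_add, hf, hg, map_add, add_smul, smul_add]; abel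
    | single m c =>
      induction b using AddMonoidAlgebra.induction_linear with
      | zero => simp
      | add f g hf hg => rw [mul_add, map_add, hf, hg, map_add, add_smul, smul_add]; abel
      | single n d =>
        rw [AddMonoidAlgebra.single_mul_single, hs, hs, hs, single_eq_smul_character,
          single_eq_smul_character]
        simp only [smul_eq_mul, smul_mul_assoc, mul_smul_comm, character_mul, pairing_add,
          add_comm n m, smul_smul, ← add_smul]
        congr 1
        push_cast
        ring)

lemma invariantField_single (u m : Lattice) (c : ℂ) :
    invariantField u (AddMonoidAlgebra.single m c) = c • (pairing m u : ℂ) • character m :=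
  Finsupp.linearCombination_single ..

lemma invariantField_character (u m : Lattice) :
    invariantField u (character m) = (pairing m u : ℂ) • character m := by
  rw [character, invariantField_single, one_smul, character]

lemma coeff_invariantField (u k : Lattice) (f : TorusRing) :
    (invariantField u f).coeff k = pairing k u * f.coeff k := by
  induction f using AddMonoidAlgebra.induction_linear with
  | zero => simp
  | add f g hf hg => simp [hf, hg, mul_add]
  | single m c =>
    rw [invariantField_single]
    by_cases h : m = k
    · subst h; simp [character, mul_comm]
    · simp [character, h]

/-- The vector field `χ^n θ_u` on the torus, with `θ_u` the invariant field of `u`. -/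
def monomialField (n u : Lattice) : Derivation ℂ TorusRing TorusRing :=
  character n • invariantField u

lemma monomialField_apply (n u : Lattice) (f : TorusRing) :
    monomialField n u f = character n * invariantField u f := rfl

lemma monomialField_character (n u m : Lattice) :
    monomialField n u (character m) = (pairing m u : ℂ) • character (n + m) := by
  rw [monomialField_apply, invariantField_character, mul_smul_comm, character_mul]

lemma dlog_monomialField (n u m : Lattice) :
    dlog m (monomialField n u) = (pairing m u : ℂ) • character n := by
  rw [dlog, monomialField_character, mul_smul_comm, character_mul]
  congr 2
  abel

lemma derivation_character (Y : Derivation ℂ TorusRing TorusRing) (m : Lattice) :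
    Y (character m) = character m * dlog m Y := by
  rw [dlog, ← mul_assoc, character_mul, add_neg_cancel, character_zero, one_mul]

lemma dlog_add_right (m : Lattice) (Y Z : Derivation ℂ TorusRing TorusRing) :
    dlog m (Y + Z) = dlog m Y + dlog m Z := by
  simp [dlog, mul_add]

lemma dlog_smul_right (m : Lattice) (c : ℂ) (Y : Derivation ℂ TorusRing TorusRing) :
    dlog m (c • Y) = c • dlog m Y := by
  simp [dlog]

lemma derivation_ext_dlog {Y Z : Derivation ℂ TorusRing TorusRing}
    (h : ∀ m, dlog m Y = dlog m Z) : Y = Z := by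
  ext1 f
  induction f using AddMonoidAlgebra.induction_linear with
  | zero => simp
  | add f g hf hg => rw [map_add, map_add, hf, hg]
  | single m c =>
    rw [single_eq_smul_character, Derivation.map_smul, Derivation.map_smul, derivation_character,
      derivation_character, h]

/-- A section is determined by its logarithmic components along two basis characters, and their
exponents lie in the finite polytope given by the pole bound `dlog_coeff'`. -/
instance (D : Ray F → ℤ) : FiniteDimensional ℂ (globalTangentSections F D) := by
  set B := {m : Lattice | ∀ ρ : Ray F, (fun ρ => -D ρ - 1) ρ ≤ pairing m ρ.1} with hB
  have hfin : Finite B := (finite_setOf_le_pairing F fun ρ => -D ρ - 1).to_subtype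
  let L : globalTangentSections F D →ₗ[ℂ] (Fin 2 × B → ℂ) :=
    { toFun := fun Y x => (dlog (Pi.single x.1 1) Y.1).coeff x.2
      map_add' := fun Y Z => by
        funext x
        simp [dlog_add_right]
      map_smul' := fun c Y => by
        funext x
        simp [dlog_smul_right] }
  refine FiniteDimensional.of_injective L fun Y Z h => Subtype.ext (derivation_ext_dlog fun m => ?_)
  have hs : ∀ i : Fin 2, dlog (Pi.single i 1) Y.1 = dlog (Pi.single i 1) Z.1 := by
    intro i
    ext k
    by_cases hk : k ∈ B
    · exact congrFun h (i, ⟨k, hk⟩)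
    · have hz : ∀ W ∈ globalTangentSections F D, (dlog (Pi.single i 1) W).coeff k = 0 := by
        intro W hW
        by_contra hne
        exact hk fun ρ => dlog_coeff' F hW ρ _ _ hne
      rw [hz _ Y.2, hz _ Z.2]
  have h0 : (Pi.single 0 1 : Lattice) = ![1, 0] := by funext i; fin_cases i <;> rfl
  have h1 : (Pi.single 1 1 : Lattice) = ![0, 1] := by funext i; fin_cases i <;> rfl
  rw [dlog_eq m Y.1, dlog_eq m Z.1, ← h0, ← h1, hs, hs]

/-! ### Coordinate vector fields as global sections -/

namespace SmoothChart

variable (C : SmoothChart F) (D : Ray F → ℤ)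

/-- The weight of the local generator of `𝒪(D)` on the chart. -/
def weight : Lattice := ∑ i, (-D (C.ray i)) • C.dual i

lemma pairing_weight (i : Fin 2) : pairing (C.weight D) (C.ray i).1 = -D (C.ray i) := by
  rw [weight, pairing_sum]
  simp only [pairing_smul, C.pairing_dual]
  simp

lemma dlog_eq_sum (m : Lattice) (Y : Derivation ℂ TorusRing TorusRing) :
    dlog m Y = ∑ i, (pairing m (C.ray i).1 : ℂ) • dlog (C.dual i) Y := by
  have : dlogHom Y m = ∑ i, pairing m (C.ray i).1 • dlogHom Y (C.dual i) := by
    conv_lhs => rw [C.eq_sum_pairing m]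
    simp only [map_sum, map_zsmul]
  simp only [Int.cast_smul_eq_zsmul]
  exact this

/-- The coordinate vector field `∂/∂x_i` of the chart, as a section of `TX(D)`. -/
def coordinateField (i : Fin 2) : Derivation ℂ TorusRing TorusRing :=
  monomialField (C.weight D - C.dual i) (C.ray i).1

lemma pairing_weight_sub (i j : Fin 2) :
    pairing (C.weight D - C.dual i) (C.ray j).1 = -D (C.ray j) - if i = j then 1 else 0 := by
  rw [pairing_sub, pairing_weight, pairing_dual]

lemma exists_ray {ρ : Ray F} (h : ρ.1 ∈ C.cone) : ∃ i, ρ = C.ray i := by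
  obtain ⟨i, hi⟩ := C.mem_cone.1 h
  exact ⟨i, Subtype.ext hi.symm⟩

lemma coordinateField_mem_tangentSections (i : Fin 2) :
    C.coordinateField D i ∈ tangentSections F D C.cone := by
  intro f hf k hk ρ hρ
  obtain ⟨j, rfl⟩ := C.exists_ray hρ
  rw [coordinateField, monomialField_apply, coeff_character_mul, coeff_invariantField] at hk
  have h1 := hf _ (right_ne_zero_of_mul hk) _ hρ
  have h2 : pairing (k - (C.weight D - C.dual i)) (C.ray i).1 ≠ 0 := by
    exact_mod_cast left_ne_zero_of_mul hk
  rw [pairing_sub, pairing_weight_sub] at h1 h2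
  split_ifs at h1 with hij
  · subst hij
    simp only [if_true] at h2
    omega
  · omega

/-- Regularity confines the exponents of the `i`-th logarithmic component to a translated dual cone
with vertex `n = C.weight D - C.dual i`. If no global section reached the vertex, neither would the
module they span over the chart ring, because the dual cone is pointed. But `coordinateField` has
the vertex as its exponent. -/
lemma exists_coeff_dlog_ne_zero (hD : TangentGloballyGenerated F D) (i : Fin 2) :
    ∃ Y ∈ globalTangentSections F D,
      (dlog (C.dual i) Y).coeff (C.weight D - C.dual i) ≠ 0 := by
  classical
  set n := C.weight D - C.dual i with hn
  by_contra! H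
  have hspan := hD C.cone C.cone_mem _ (C.coordinateField_mem_tangentSections D i)
  have key : ∀ Y ∈ Submodule.span (chartRing C.cone)
      (globalTangentSections F D : Set (Derivation ℂ TorusRing TorusRing)),
      ∀ k, (dlog (C.dual i) Y).coeff k ≠ 0 →
        k ≠ n ∧ ∀ j, pairing n (C.ray j).1 ≤ pairing k (C.ray j).1 := by
    intro Y hY
    induction hY using Submodule.span_induction with
    | mem Y hY =>
      intro k hk
      refine ⟨fun h => hk (h ▸ H Y hY), fun j => ?_⟩
      rw [hn, pairing_weight_sub]
      split_ifs with hij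
      · exact dlog_coeff' F hY _ _ _ hk
      · have hp : pairing (C.dual i) (C.ray j).1 = 0 := by rw [C.pairing_dual, if_neg hij]
        have := dlog_coeff F hY (C.ray j) _ hp.ge k hk
        rw [pairing_add, hp] at this
        omega
    | zero => intro k hk; simp [dlog] at hk
    | add Y Z _ _ hY hZ =>
      intro k hk
      rw [dlog_add_right, AddMonoidAlgebra.coeff_add, Finsupp.add_apply] at hk
      by_cases h : (dlog (C.dual i) Y).coeff k = 0
      · rw [h, zero_add] at hk
        exact hZ k hk
      · exact hY k h
    | smul f Y _ hY =>
      intro k hk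
      have : dlog (C.dual i) (f • Y) = f.1 * dlog (C.dual i) Y := by
        change character _ * (f.1 * Y (character _)) = _
        rw [dlog]; ring
      rw [this] at hk
      obtain ⟨a, ha, b, hb, rfl⟩ := Finset.mem_add.1
        (AddMonoidAlgebra.support_coeff_mul_subset _ _ (Finsupp.mem_support_iff.2 hk))
      obtain ⟨hbn, hb⟩ := hY b (Finsupp.mem_support_iff.1 hb)
      have ha' : ∀ j, 0 ≤ pairing a (C.ray j).1 := fun j =>
        f.2 a (Finsupp.mem_support_iff.1 ha) _ (C.ray_mem_cone j)
      refine ⟨fun h => hbn (sub_eq_zero.1 (C.eq_zero_of_pairing fun j => ?_)), fun j => ?_⟩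
      · rw [pairing_sub]
        have h1 := hb j
        have h2 := ha' j
        rw [← h, pairing_add] at h1 ⊢
        omega
      · have h1 := hb j
        have h2 := ha' j
        rw [pairing_add]
        omega
  refine (key _ hspan n ?_).1 rfl
  rw [coordinateField, dlog_monomialField, C.pairing_dual]
  simp [character, hn]

/-- If `TX(D)` is globally generated, then the coordinate vector fields of every chart extend to
global sections. -/
lemma coordinateField_mem (hD : TangentGloballyGenerated F D) (i : Fin 2) :
    C.coordinateField D i ∈ globalTangentSections F D := by
  obtain ⟨Y, hY, hne⟩ := C.exists_coeff_dlog_ne_zero D hD i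
  have hm : ∀ m, pairing m (C.ray i).1 ≠ 0 → (dlog m Y).coeff (C.weight D - C.dual i) ≠ 0 := by
    intro m hm
    -- The exponent has order `-D - 1` along ray `i`, one less than is allowed for a character
    -- orthogonal to that ray. So this graded part of `Y` is a nonzero multiple of the coordinate
    -- field, which inherits the regularity of `Y`.
    have hz : ∀ j, j ≠ i → (dlog (C.dual j) Y).coeff (C.weight D - C.dual i) = 0 := by
      intro j hj
      by_contra h
      have hp : pairing (C.dual j) (C.ray i).1 = 0 := by rw [C.pairing_dual, if_neg hj]
      have := dlog_coeff F hY (C.ray i) _ hp.ge _ h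
      rw [pairing_add, hp, pairing_weight_sub, if_pos rfl] at this
      omega
    rw [C.dlog_eq_sum m Y, AddMonoidAlgebra.coeff_sum, Finsupp.finsetSum_apply,
      Finset.sum_eq_single i (fun j _ hj => by simp [hz j hj]) (by simp)]
    simp [hne, hm]
  simp only [globalTangentSections, Submodule.mem_iInf]
  intro σ hσ f hf k hk ρ hρ
  rw [coordinateField, monomialField_apply, coeff_character_mul, coeff_invariantField] at hk
  have h1 := hf _ (right_ne_zero_of_mul hk) _ hρ
  have h2 := hm _ (by exact_mod_cast left_ne_zero_of_mul hk)
  have := dlog_coeff F hY ρ _ h1 _ h2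
  rwa [add_sub_cancel] at this

/-! ### Coordinates on a chart -/

/-- The identification of the polynomial ring with the coordinate ring of the chart. -/
def coords : MvPolynomial (Fin 2) ℂ →ₐ[ℂ] TorusRing := aeval fun i => character (C.dual i)

lemma character_nsmul (m : Lattice) (n : ℕ) : character m ^ n = character (n • m) := by
  simp [character, AddMonoidAlgebra.single_pow]

lemma coords_monomial (e : Fin 2 →₀ ℕ) (c : ℂ) :
    C.coords (monomial e c) = AddMonoidAlgebra.single (∑ i, e i • C.dual i) c := by
  rw [coords, aeval_monomial, Finsupp.prod_fintype _ _ (by simp), AddMonoidAlgebra.coe_algebraMap]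
  simp only [character_nsmul, Fin.prod_univ_two, character_mul, Fin.sum_univ_two]
  simp [character, AddMonoidAlgebra.single_mul_single]

lemma coords_injective : Function.Injective C.coords := by
  set φ : (Fin 2 →₀ ℕ) → Lattice := fun e => ∑ i, e i • C.dual i with hφ
  have hinj : Function.Injective φ := by
    intro e e' h
    have hp : ∀ (e : Fin 2 →₀ ℕ) j, pairing (φ e) (C.ray j).1 = e j := by
      intro e j
      simp only [hφ, pairing_sum, ← natCast_zsmul, pairing_smul, C.pairing_dual]
      simp
    ext j
    have := hp e j
    rw [h, hp] at this
    exact_mod_cast this.symm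
  have : ∀ p, C.coords p = AddMonoidAlgebra.mapDomain φ p := by
    intro p
    induction p using MvPolynomial.induction_on' with
    | monomial e c =>
      exact (C.coords_monomial e c).trans
        (AddMonoidAlgebra.mapDomain_single (f := φ) (a := e) (r := c)).symm
    | add p q hp hq => rw [map_add, hp, hq]; exact (AddMonoidAlgebra.mapDomain_add ..).symm
  intro p q h
  rw [this, this] at h
  exact AddMonoidAlgebra.mapDomain_injective hinj h

lemma character_mem_range {m : Lattice} (hm : ∀ i, 0 ≤ pairing m (C.ray i).1) :
    ∃ p, C.coords p = character m := by
  refine ⟨monomial (Finsupp.equivFunOnFinite.symm fun i => (pairing m (C.ray i).1).toNat) 1, ?_⟩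
  rw [coords_monomial, character]
  congr 1
  conv_rhs => rw [C.eq_sum_pairing m]
  refine Finset.sum_congr rfl fun i _ => ?_
  rw [← natCast_zsmul]
  simp [hm i]

lemma mem_range_coords {f : TorusRing}
    (hf : ∀ m, f.coeff m ≠ 0 → ∀ i, 0 ≤ pairing m (C.ray i).1) :
    f ∈ LinearMap.range C.coords.toLinearMap := by
  have : f = ∑ m ∈ f.coeff.support, f.coeff m • character m := by
    ext k
    rw [AddMonoidAlgebra.coeff_sum, Finsupp.finsetSum_apply, Finset.sum_eq_single k]
    · simp [character]
    · intro m _ hm; simp [character, hm]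
    · intro h; simp [Finsupp.notMem_support_iff.1 h]
  rw [this]
  refine Submodule.sum_mem _ fun m hm => Submodule.smul_mem _ _ ?_
  exact C.character_mem_range (hf m (Finsupp.mem_support_iff.1 hm))

lemma coords_mem_chartRing (p : MvPolynomial (Fin 2) ℂ) {τ : Finset Lattice} (hτ : τ ⊆ C.cone) :
    C.coords p ∈ chartRing τ := by
  induction p using MvPolynomial.induction_on with
  | C a => rw [← MvPolynomial.algebraMap_eq, AlgHom.commutes]; exact Subalgebra.algebraMap_mem _ a
  | add p q hp hq => rw [map_add]; exact Subalgebra.add_mem _ hp hq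
  | mul_X p i hp =>
    rw [map_mul]
    refine Subalgebra.mul_mem _ hp ?_
    intro m hm v hv
    rw [coords, aeval_X] at hm
    have : m = C.dual i := by
      by_contra hne
      exact hm (by simp [character, Ne.symm hne])
    obtain ⟨j, rfl⟩ := C.mem_cone.1 (hτ hv)
    rw [this, C.pairing_dual]
    split_ifs <;> norm_num

/-- The invariant field of ray `i` is `x_i ∂/∂x_i` in the chart. -/
lemma coords_pderiv (i : Fin 2) (p : MvPolynomial (Fin 2) ℂ) :
    C.coords (pderiv i p) = character (-C.dual i) * invariantField (C.ray i).1 (C.coords p) := by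
  induction p using MvPolynomial.induction_on with
  | C a =>
    rw [← MvPolynomial.algebraMap_eq, AlgHom.commutes, Derivation.map_algebraMap,
      Derivation.map_algebraMap, map_zero, mul_zero]
  | add p q hp hq => simp only [map_add, hp, hq, mul_add]
  | mul_X p j hp =>
    have hX : C.coords (X j) = character (C.dual j) := aeval_X ..
    simp only [Derivation.leibniz, map_add, map_mul, hp, smul_eq_mul, mul_add, hX,
      invariantField_character, C.pairing_dual, pderiv_X]
    congr 1
    · by_cases h : j = i
      · subst h
        simp only [Pi.single_eq_same, map_one, if_true, Int.cast_one, one_smul]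
        rw [mul_left_comm, character_mul, neg_add_cancel, character_zero]
      · simp [h]
    · ring

lemma localCoeff_aux (i : Fin 2) (Y : globalTangentSections F D) :
    character (-C.weight D) * Y.1 (character (C.dual i)) ∈
      LinearMap.range C.coords.toLinearMap := by
  refine C.mem_range_coords fun m hm j => ?_
  rw [coeff_character_mul] at hm
  have hY := Y.2
  simp only [globalTangentSections, Submodule.mem_iInf] at hY
  have := hY C.cone C.cone_mem (character (C.dual i)) (by
    simpa [coords] using C.coords_mem_chartRing (X i) subset_rfl) _ hm _ (C.ray_mem_cone j)
  rw [sub_neg_eq_add, pairing_add, pairing_weight] at this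
  omega

/-- The components of a global section of `TX(D)` with respect to the coordinate vector fields. -/
def localCoeff (i : Fin 2) : globalTangentSections F D →ₗ[ℂ] MvPolynomial (Fin 2) ℂ :=
  (LinearEquiv.ofInjective C.coords.toLinearMap C.coords_injective).symm.toLinearMap ∘ₗ
    LinearMap.codRestrict (LinearMap.range C.coords.toLinearMap)
      { toFun := fun Y => character (-C.weight D) * Y.1 (character (C.dual i))
        map_add' := fun Y Z => by simp [mul_add]
        map_smul' := fun c Y => by simp } (C.localCoeff_aux D i)

lemma coords_localCoeff (i : Fin 2) (Y : globalTangentSections F D) :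
    C.coords (C.localCoeff D i Y) = character (-C.weight D) * Y.1 (character (C.dual i)) := by
  have := LinearEquiv.apply_symm_apply
    (LinearEquiv.ofInjective C.coords.toLinearMap C.coords_injective)
    ⟨_, C.localCoeff_aux D i Y⟩
  exact congrArg Subtype.val this

lemma dlog_dual (i : Fin 2) (Y : globalTangentSections F D) :
    dlog (C.dual i) Y.1 = character (C.weight D - C.dual i) * C.coords (C.localCoeff D i Y) := by
  rw [coords_localCoeff, ← mul_assoc, character_mul, dlog]
  congr 2
  abel

lemma localCoeff_coordinateField (hD : TangentGloballyGenerated F D) (i j : Fin 2) :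
    C.localCoeff D i ⟨C.coordinateField D j, C.coordinateField_mem D hD j⟩ =
      if i = j then 1 else 0 := by
  apply C.coords_injective
  rw [coords_localCoeff]
  change character _ * monomialField _ _ (character _) = _
  rw [monomialField_character, C.pairing_dual]
  split_ifs with h
  · subst h
    rw [Int.cast_one, one_smul, character_mul, map_one, ← character_zero]
    congr 1
    abel
  · simp

/-- The divergence, in one chart, of a coordinate vector field of another chart. -/
lemma coords_divergence (C' : SmoothChart F) (hD : TangentGloballyGenerated F D) (j : Fin 2) :
    C.coords (∑ i, pderiv i (C.localCoeff D i
        ⟨C'.coordinateField D j, C'.coordinateField_mem D hD j⟩)) =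
      (pairing (C'.weight D - C'.dual j - (C.weight D - ∑ i, C.dual i)) (C'.ray j).1 : ℂ) •
        character (C'.weight D - C'.dual j - C.weight D) := by
  set n := C'.weight D - C'.dual j with hn
  set u := (C'.ray j).1
  have h : ∀ i, C.coords (pderiv i (C.localCoeff D i
      ⟨C'.coordinateField D j, C'.coordinateField_mem D hD j⟩)) =
      ((pairing (n - (C.weight D - ∑ i, C.dual i)) (C.ray i).1 * pairing (C.dual i) u : ℤ) : ℂ) •
        character (n - C.weight D) := by
    intro i
    rw [coords_pderiv, coords_localCoeff]
    change character _ * invariantField _ (character _ * monomialField n u (character _)) = _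
    rw [monomialField_character, mul_smul_comm,
      Derivation.map_smul, character_mul, invariantField_character, mul_smul_comm, mul_smul_comm,
      character_mul, smul_smul, ← Int.cast_mul, mul_comm (pairing (C.dual i) _)]
    have h1 : -C.weight D + (n + C.dual i) = n - C.weight D + C.dual i := by abel
    -- The exponent of `x_i` before differentiation is one larger than in `n - C.weight D`; adding
    -- all the `C.dual` absorbs this `1` uniformly in `i`, so the sum collapses by `pairing_eq_sum`.
    have h2 : pairing (n - C.weight D + C.dual i) (C.ray i).1 =
        pairing (n - (C.weight D - ∑ i, C.dual i)) (C.ray i).1 := by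
      simp only [pairing_sub, pairing_add, pairing_sum, C.pairing_dual]
      simp
      ring
    rw [h1, h2]
    congr 2
    abel
  rw [map_sum]
  simp only [h, ← Finset.sum_smul, ← Int.cast_sum, ← C.pairing_eq_sum]

/-- Vanishing of the divergence of the coordinate fields of all charts says that `-D - 1` is the
pairing with a single character, so `D` is linearly equivalent to `K_X`. The pole bound for one
coordinate field then makes `C.dual 1` nonnegative on every ray, which completeness forbids. -/
lemma exists_divergence_ne_zero (hD : TangentGloballyGenerated F D) :
    ∃ Y : globalTangentSections F D, ∑ i, pderiv i (C.localCoeff D i Y) ≠ 0 := by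
  by_contra! H
  have hray : ∀ ρ : Ray F, pairing (C.weight D - ∑ i, C.dual i) ρ.1 = -D ρ - 1 := by
    intro ρ
    obtain ⟨C', hC'⟩ := exists_smoothChart_of_ray ρ
    obtain ⟨j, rfl⟩ := C'.exists_ray hC'
    have h := C.coords_divergence D C' hD j
    rw [H, map_zero, pairing_sub, pairing_weight_sub, if_pos rfl] at h
    have := congrArg (fun f : TorusRing =>
      f.coeff (C'.weight D - C'.dual j - C.weight D)) h
    simp only [character, AddMonoidAlgebra.coeff_zero, Finsupp.coe_zero, Pi.zero_apply,
      AddMonoidAlgebra.coeff_smul, Finsupp.smul_apply, AddMonoidAlgebra.coeff_single,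
      Finsupp.single_eq_same, smul_eq_mul, mul_one] at this
    have : -D (C'.ray j) - 1 - pairing (C.weight D - ∑ i, C.dual i) (C'.ray j).1 = 0 := by
      exact_mod_cast this.symm
    omega
  have hd : C.dual 1 = 0 := by
    refine eq_zero_of_pairing_nonneg F fun ρ => ?_
    have h := dlog_coeff' F (C.coordinateField_mem D hD 0) ρ (C.dual 0) (C.weight D - C.dual 0) (by
      rw [coordinateField, dlog_monomialField, C.pairing_dual]
      simp [character])
    have h2 := hray ρ
    rw [Fin.sum_univ_two, pairing_sub, pairing_add] at h2
    rw [pairing_sub] at h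
    omega
  have := C.pairing_dual 1 1
  rw [hd, pairing_zero] at this
  simp at this

end SmoothChart

/-! ### Specialization of the homogeneous coordinates -/

/-- The value of a Laurent monomial at a point of the torus of the homogeneous coordinates. -/
def monomialValue (w : Ray F → ℂˣ) (e : Ray F → ℤ) : ℂˣ := ∏ ρ, w ρ ^ e ρ

lemma monomialValue_add (w : Ray F → ℂˣ) (e e' : Ray F → ℤ) :
    monomialValue w (e + e') = monomialValue w e * monomialValue w e' := by
  simp [monomialValue, zpow_add, Finset.prod_mul_distrib]

lemma monomialValue_zero (w : Ray F → ℂˣ) : monomialValue w 0 = 1 := by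
  simp [monomialValue]

lemma pullback_character (m : Lattice) :
    pullback F (character m) = zMonomial (charExponent F m) :=
  AddMonoidAlgebra.mapDomain_single (f := charExponent F) (a := m) (r := (1 : ℂ))

lemma zMonomial_mul (e e' : Ray F → ℤ) : zMonomial e * zMonomial e' = zMonomial (e + e') := by
  simp [AddMonoidAlgebra.single_mul_single]

/-- The degree of `A_ρ`, as a divisor. -/
def contractionDegree (D : Ray F → ℤ) (ρ : Ray F) : Ray F → ℤ :=
  fun τ => D τ + 1 - if τ = ρ then 1 else 0

/-- A character that generates the annihilator of a one-parameter subgroup. -/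
def orthogonal (v : Lattice) : Lattice := ![v 1, -v 0]

lemma pairing_orthogonal (v u : Lattice) : pairing (orthogonal v) u = v 1 * u 0 - v 0 * u 1 := by
  simp [pairing, orthogonal]; ring

lemma pairing_orthogonal_self (v : Lattice) : pairing (orthogonal v) v = 0 := by
  rw [pairing_orthogonal]; ring

namespace SmoothChart

variable (C : SmoothChart F)

/-- The restriction of the exponents of a Laurent monomial to the rays of the chart. -/
def chartExponent : (Ray F → ℤ) →+ Lattice where
  toFun e := ∑ i, e (C.ray i) • C.dual i
  map_zero' := by simp
  map_add' e e' := by simp only [Pi.add_apply, add_smul, Finset.sum_add_distrib]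

lemma chartExponent_apply (e : Ray F → ℤ) : C.chartExponent e = ∑ i, e (C.ray i) • C.dual i := rfl

lemma pairing_chartExponent (e : Ray F → ℤ) (j : Fin 2) :
    pairing (C.chartExponent e) (C.ray j).1 = e (C.ray j) := by
  rw [chartExponent_apply, pairing_sum]
  simp only [pairing_smul, C.pairing_dual]
  simp

lemma chartExponent_charExponent (m : Lattice) : C.chartExponent (charExponent F m) = m :=
  (C.eq_sum_pairing m).symm

/-- The restriction of Laurent polynomials to the translate of the torus of the chart by `w`. -/
def specialize (w : Ray F → ℂˣ) : CoxLaurent F →ₐ[ℂ] TorusRing :=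
  AddMonoidAlgebra.lift ℂ TorusRing (Ray F → ℤ)
    { toFun := fun e => (monomialValue w e.toAdd : ℂ) • character (C.chartExponent e.toAdd)
      map_one' := by simp [monomialValue_zero, character_zero]
      map_mul' := fun e e' => by
        simp only [toAdd_mul, monomialValue_add, map_add, Units.val_mul, smul_mul_assoc,
          mul_smul_comm, smul_smul, character_mul]
        congr 1
        exact mul_comm _ _ }

lemma specialize_single (w : Ray F → ℂˣ) (e : Ray F → ℤ) (c : ℂ) :
    C.specialize w (AddMonoidAlgebra.single e c) =
      c • (monomialValue w e : ℂ) • character (C.chartExponent e) :=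
  AddMonoidAlgebra.lift_single ..

lemma specialize_zMonomial (w : Ray F → ℂˣ) (e : Ray F → ℤ) :
    C.specialize w (zMonomial e) = (monomialValue w e : ℂ) • character (C.chartExponent e) := by
  rw [zMonomial, specialize_single, one_smul]

/-- Setting the variables off the chart to `1` gives a retraction onto the chart; it brings
membership in `J S_σ` back to the chart ring. -/
lemma specialize_one_pullback (f : TorusRing) : C.specialize 1 (pullback F f) = f := by
  induction f using AddMonoidAlgebra.induction_linear with
  | zero => simp
  | add f g hf hg => rw [map_add, map_add, hf, hg]
  | single m c =>
    rw [single_eq_smul_character, map_smul, map_smul, pullback_character, specialize_zMonomial,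
      chartExponent_charExponent]
    simp [monomialValue]

lemma specialize_mem (w : Ray F → ℂˣ) {τ : Finset Lattice} (hτ : τ ⊆ C.cone) {f : CoxLaurent F}
    (hf : f ∈ coxLocalization F τ) : C.specialize w f ∈ chartRing τ := by
  have : C.specialize w f = f.coeff.sum fun e c =>
      c • ((monomialValue w e : ℂ) • character (C.chartExponent e)) :=
    AddMonoidAlgebra.lift_apply ..
  rw [this]
  refine Subalgebra.sum_mem _ fun e he => Subalgebra.smul_mem _ (Subalgebra.smul_mem _ ?_ _) _
  intro m hm v hv
  have : m = C.chartExponent e := by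
    by_contra hne
    exact hm (by simp [character, Ne.symm hne])
  obtain ⟨j, rfl⟩ := C.mem_cone.1 (hτ hv)
  rw [this, C.pairing_chartExponent]
  exact hf e (Finsupp.mem_support_iff.1 he) _ hv

/-! ### The singular ideal on a chart -/

variable {D : Ray F → ℤ} (Y : globalTangentSections F D)

/-- The exponents of the monomial factor in the part of `A_ρ` that involves the `i`-th component of
the vector field. -/
def coefficientExponent (D : Ray F → ℤ) (ρ : Ray F) (i : Fin 2) : Ray F → ℤ :=
  contractionDegree D ρ + charExponent F (C.weight D - C.dual i)

lemma coefficientExponent_ray (ρ : Ray F) (i j : Fin 2) :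
    C.coefficientExponent D ρ i (C.ray j) =
      1 - (if C.ray j = ρ then 1 else 0) - if i = j then 1 else 0 := by
  have : charExponent F (C.weight D - C.dual i) (C.ray j) =
    pairing (C.weight D - C.dual i) (C.ray j).1 := rfl
  rw [coefficientExponent, Pi.add_apply, this, contractionDegree, pairing_weight_sub]
  ring

lemma toCoxLaurent_contractVolume_eq_sum (ρ : Ray F) :
    toCoxLaurent F (contractVolume F D Y.1 ρ) =
      ∑ i, (pairing (orthogonal ρ.1) (C.ray i).1 : ℂ) •
        (zMonomial (C.coefficientExponent D ρ i) * pullback F (C.coords (C.localCoeff D i Y))) := by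
  rw [contractVolume, toCoxLaurent_homogenize F _ _ (contractVolume_exponent_nonneg F Y.2 ρ),
    torusContraction_eq, C.dlog_eq_sum, map_sum, Finset.mul_sum]
  refine Finset.sum_congr rfl fun i _ => ?_
  rw [map_smul, mul_smul_comm, dlog_dual, map_mul, pullback_character, ← mul_assoc, zMonomial_mul]
  rfl

lemma pairing_orthogonal_ne_zero {i j : Fin 2} (h : i ≠ j) :
    pairing (orthogonal (C.ray j).1) (C.ray i).1 ≠ 0 := by
  intro h0
  have hz : orthogonal (C.ray j).1 = 0 := C.eq_zero_of_pairing fun k => by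
    by_cases hk : k = j
    · rw [hk, pairing_orthogonal_self]
    · rwa [show k = i by omega]
  refine ne_zero_of_singleton_mem_cones (C.ray j).2 (funext fun k => ?_)
  have h1 := congrFun hz 0
  have h2 := congrFun hz 1
  simp only [orthogonal, Matrix.cons_val_zero, Matrix.cons_val_one, Pi.zero_apply,
    neg_eq_zero] at h1 h2
  fin_cases k
  · exact h2
  · exact h1

/-- The contraction at ray `j` uses a character orthogonal to that ray, so only the other component
of the field survives. -/
lemma toCoxLaurent_contractVolume_ray {i j : Fin 2} (h : i ≠ j) :
    toCoxLaurent F (contractVolume F D Y.1 (C.ray j)) =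
      (pairing (orthogonal (C.ray j).1) (C.ray i).1 : ℂ) •
        (zMonomial (C.coefficientExponent D (C.ray j) i) *
          pullback F (C.coords (C.localCoeff D i Y))) := by
  rw [C.toCoxLaurent_contractVolume_eq_sum, Finset.sum_eq_single i _ (by simp)]
  intro k _ hk
  rw [show k = j by omega, pairing_orthogonal_self, Int.cast_zero, zero_smul]

/-- The monomial factor thus involves only variables off the chart, which are invertible in `S_σ`.
-/
lemma coefficientExponent_ray_eq_zero {i j : Fin 2} (h : i ≠ j) (k : Fin 2) :
    C.coefficientExponent D (C.ray j) i (C.ray k) = 0 := by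
  rw [coefficientExponent_ray]
  by_cases hk : k = j
  · subst hk; simp [h]
  · rw [if_neg (C.ray_ne hk), if_pos (by omega)]; norm_num

lemma smul_zMonomial_mem {τ : Finset Lattice} (c : ℂ) {e : Ray F → ℤ}
    (h : c ≠ 0 → ∀ ρ : Ray F, ρ.1 ∈ τ → 0 ≤ e ρ) : c • zMonomial e ∈ coxLocalization F τ := by
  intro k hk ρ hρ
  have : k = e := by
    by_contra hne
    exact hk (by simp [Ne.symm hne])
  refine this ▸ h ?_ ρ hρ
  rintro rfl
  simp at hk

/-- The coordinate functions of the chart, as elements of the ring of a smaller chart. -/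
def coordsRestrict {τ : Finset Lattice} (hτ : τ ⊆ C.cone) :
    MvPolynomial (Fin 2) ℂ →ₐ[ℂ] chartRing τ :=
  C.coords.codRestrict _ fun p => C.coords_mem_chartRing p hτ

/-- The singular scheme is defined, on a chart, by the components of the vector field. -/
lemma chartIdeal_singularIdeal {τ : Finset Lattice} (hτ : τ ⊆ C.cone) :
    chartIdeal F (singularIdeal F (contractVolume F D Y.1)) τ =
      (Ideal.span (Set.range fun i => C.localCoeff D i Y)).map (C.coordsRestrict hτ) := by
  apply le_antisymm
  · intro g hg
    let r : coxLocalization F τ →ₐ[ℂ] chartRing τ :=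
      ((C.specialize 1).comp (coxLocalization F τ).val).codRestrict _
        fun f => C.specialize_mem 1 hτ f.2
    have hr : r (chartToLocalization F τ g) = g := Subtype.ext (C.specialize_one_pullback g.1)
    rw [← hr]
    have hle : (singularIdeal F (contractVolume F D Y.1)).map (coxToLocalization F τ) ≤
        ((Ideal.span (Set.range fun i => C.localCoeff D i Y)).map (C.coordsRestrict hτ)).comap r := by
      rw [Ideal.map_le_iff_le_comap, singularIdeal, Ideal.span_le]
      rintro _ ⟨ρ, rfl⟩
      rw [SetLike.mem_coe, Ideal.mem_comap, Ideal.mem_comap]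
      have hmem : ∀ i, (pairing (orthogonal ρ.1) (C.ray i).1 : ℂ) •
          (zMonomial (C.coefficientExponent D ρ i) : CoxLaurent F) ∈ coxLocalization F τ := by
        intro i
        -- A negative exponent occurs only at `ρ = C.ray i`, and there the scalar vanishes.
        refine smul_zMonomial_mem _ fun hne ρ' hρ' => ?_
        obtain ⟨j, rfl⟩ := C.exists_ray (hτ hρ')
        rw [coefficientExponent_ray]
        have : ¬ (C.ray j = ρ ∧ i = j) := by
          rintro ⟨rfl, rfl⟩
          exact hne (by rw [pairing_orthogonal_self, Int.cast_zero])
        split_ifs <;> first | omega | tauto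
      have hsum : r (coxToLocalization F τ (contractVolume F D Y.1 ρ)) =
          ∑ i, r ⟨_, hmem i⟩ * C.coordsRestrict hτ (C.localCoeff D i Y) := by
        apply Subtype.ext
        change C.specialize 1 (toCoxLaurent F _) = _
        rw [C.toCoxLaurent_contractVolume_eq_sum, map_sum, AddSubmonoidClass.coe_finsetSum]
        refine Finset.sum_congr rfl fun i _ => ?_
        rw [← smul_mul_assoc, map_mul, specialize_one_pullback]
        rfl
      rw [hsum]
      exact Ideal.sum_mem _ fun i _ => Ideal.mul_mem_left _ _
        (Ideal.mem_map_of_mem _ (Ideal.subset_span (Set.mem_range_self i)))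
    exact hle hg
  · rw [Ideal.map_le_iff_le_comap, Ideal.span_le]
    rintro _ ⟨i, rfl⟩
    rw [SetLike.mem_coe, Ideal.mem_comap, chartIdeal, Ideal.mem_comap]
    obtain ⟨j, hij⟩ : ∃ j : Fin 2, i ≠ j := ⟨1 - i, by omega⟩
    set c : ℂ := (pairing (orthogonal (C.ray j).1) (C.ray i).1 : ℂ) with hc
    have hc0 : c ≠ 0 := Int.cast_ne_zero.2 (C.pairing_orthogonal_ne_zero hij)
    have hmem : c⁻¹ • (zMonomial (-C.coefficientExponent D (C.ray j) i) : CoxLaurent F) ∈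
        coxLocalization F τ := by
      refine smul_zMonomial_mem _ fun _ ρ hρ => ?_
      obtain ⟨k, rfl⟩ := C.exists_ray (hτ hρ)
      rw [Pi.neg_apply, C.coefficientExponent_ray_eq_zero hij, neg_zero]
    have : chartToLocalization F τ (C.coordsRestrict hτ (C.localCoeff D i Y)) =
        ⟨_, hmem⟩ * coxToLocalization F τ (contractVolume F D Y.1 (C.ray j)) := by
      apply Subtype.ext
      change pullback F (C.coords _) = c⁻¹ • zMonomial _ * toCoxLaurent F _
      rw [C.toCoxLaurent_contractVolume_ray Y hij, mul_smul_comm, ← hc, smul_mul_assoc, smul_smul,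
        mul_inv_cancel₀ hc0, one_smul, ← mul_assoc, zMonomial_mul, neg_add_cancel]
      exact (one_mul _).symm
    rw [this]
    exact Ideal.mul_mem_left _ _ (Ideal.mem_map_of_mem _ (Ideal.subset_span (Set.mem_range_self _)))

/-- An affine chart contained in a two-dimensional one is a principal open subset. -/
lemma exists_isLocalizationAway {τ : Finset Lattice} (hτ : τ ⊆ C.cone) :
    letI := (C.coordsRestrict hτ).toRingHom.toAlgebra
    ∃ s : MvPolynomial (Fin 2) ℂ, IsLocalization.Away s (chartRing τ) := by
  classical
  let := (C.coordsRestrict hτ).toRingHom.toAlgebra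
  have halg : ∀ p, (algebraMap (MvPolynomial (Fin 2) ℂ) (chartRing τ) p).1 = C.coords p := fun p => rfl
  -- The product of the coordinates whose divisors are removed in passing to the smaller chart.
  set m : Lattice := ∑ i, (if (C.ray i).1 ∈ τ then (0 : ℤ) else 1) • C.dual i with hm
  have hmp : ∀ i, pairing m (C.ray i).1 = if (C.ray i).1 ∈ τ then 0 else 1 := by
    intro i
    simp only [hm, pairing_sum, pairing_smul, C.pairing_dual]
    simp
  obtain ⟨s, hs⟩ := C.character_mem_range (m := m) fun i => by rw [hmp]; split_ifs <;> norm_num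
  refine ⟨s, IsLocalization.Away.mk s ?_ ?_ ?_⟩
  · have hinv : character (-m) ∈ chartRing τ := by
      intro k hk v hv
      have : k = -m := by
        by_contra hne
        exact hk (by simp [character, Ne.symm hne])
      obtain ⟨j, rfl⟩ := C.mem_cone.1 (hτ hv)
      have h0 : pairing (-m) (C.ray j).1 = - pairing m (C.ray j).1 := by simp [pairing]; ring
      rw [this, h0, hmp, if_pos hv, neg_zero]
    refine IsUnit.of_mul_eq_one ⟨_, hinv⟩ (Subtype.ext ?_)
    change C.coords s * character (-m) = 1
    rw [hs, character_mul, add_neg_cancel, character_zero]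
  · intro g
    obtain ⟨N, hN⟩ : ∃ N : ℕ, ∀ k ∈ g.1.coeff.support, ∀ i, -pairing k (C.ray i).1 ≤ N := by
      refine ⟨∑ k ∈ g.1.coeff.support, ∑ i, (pairing k (C.ray i).1).natAbs, fun k hk i => ?_⟩
      have h1 := Finset.single_le_sum (f := fun i => (pairing k (C.ray i).1).natAbs)
        (fun _ _ => Nat.zero_le _) (Finset.mem_univ i)
      have h2 := Finset.single_le_sum (f := fun k => ∑ i, (pairing k (C.ray i).1).natAbs)
        (fun _ _ => Nat.zero_le _) hk
      beta_reduce at h1 h2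
      omega
    obtain ⟨p, hp⟩ := C.mem_range_coords (f := character (N • m) * g.1) (by
      intro k hk i
      rw [coeff_character_mul] at hk
      have h1 := hN _ (Finsupp.mem_support_iff.2 hk) i
      have h2 : (C.ray i).1 ∈ τ → 0 ≤ pairing (k - N • m) (C.ray i).1 := fun h => g.2 _ hk _ h
      rw [← natCast_zsmul, pairing_sub, pairing_smul, hmp] at h1 h2
      split_ifs at h1 h2 with h
      · have := h2 h
        omega
      · omega)
    refine ⟨N, p, Subtype.ext ?_⟩
    rw [halg, ← map_pow]
    change g.1 * C.coords (s ^ N) = _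
    rw [map_pow, hs, character_nsmul, mul_comm]
    exact hp.symm
  · intro a b hab
    exact ⟨0, by rw [C.coords_injective (congrArg Subtype.val hab)]⟩

/-- The Jacobian criterion applies on the full chart, and localization commutes with radicals. -/
lemma isReduced_quotient_chartIdeal {τ : Finset Lattice} (hτ : τ ⊆ C.cone)
    (h : ∀ q : Fin 2 → ℂ, (∀ i, eval q (C.localCoeff D i Y) = 0) →
      eval q (Matrix.of fun i k => pderiv k (C.localCoeff D i Y)).det ≠ 0) :
    IsReduced (chartRing τ ⧸ chartIdeal F (singularIdeal F (contractVolume F D Y.1)) τ) := by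
  let := (C.coordsRestrict hτ).toRingHom.toAlgebra
  obtain ⟨s, hs⟩ := C.exists_isLocalizationAway hτ
  rw [← Ideal.isRadical_iff_quotient_reduced, C.chartIdeal_singularIdeal Y hτ]
  have hrad := isRadical_span_of_jacobian_ne_zero (fun i => C.localCoeff D i Y) h
  have := IsLocalization.map_radical (Submonoid.powers s) (chartRing τ)
    (Ideal.span (Set.range fun i => C.localCoeff D i Y))
  rw [hrad.radical] at this
  exact Ideal.radical_eq_iff.1 this.symm

/-! ### The exterior derivative on a chart -/

/-- The restriction of homogeneous coordinates to the translate of the chart by `w`. -/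
def slice (w : Ray F → ℂˣ) : CoxRing F →ₐ[ℂ] MvPolynomial (Fin 2) ℂ :=
  aeval fun ρ => MvPolynomial.C (w ρ : ℂ) * ∏ i, if C.ray i = ρ then X i else 1

/-- The pullback of functions under the action of the torus on the chart. -/
def scale (w : Ray F → ℂˣ) : MvPolynomial (Fin 2) ℂ →ₐ[ℂ] MvPolynomial (Fin 2) ℂ :=
  aeval fun i => MvPolynomial.C (monomialValue w (charExponent F (C.dual i)) : ℂ) * X i

lemma coords_C_mul (c : ℂ) (p : MvPolynomial (Fin 2) ℂ) :
    C.coords (MvPolynomial.C c * p) = c • C.coords p := by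
  rw [← smul_eq_C_mul, map_smul]

lemma coords_slice (w : Ray F → ℂˣ) (f : CoxRing F) :
    C.coords (C.slice w f) = C.specialize w (toCoxLaurent F f) := by
  have : C.coords.comp (C.slice w) = (C.specialize w).comp (toCoxLaurent F) := by
    refine algHom_ext fun ρ => ?_
    simp only [AlgHom.comp_apply, slice, aeval_X, toCoxLaurent]
    rw [coords_C_mul, specialize_single, one_smul, map_prod]
    congr 1
    · simp [monomialValue, Pi.single_apply]
    · rw [chartExponent_apply, Fin.prod_univ_two, Fin.sum_univ_two, ← character_mul]
      have : ∀ i, C.coords (if C.ray i = ρ then X i else 1) =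
          character ((Pi.single ρ 1 : Ray F → ℤ) (C.ray i) • C.dual i) := by
        intro i
        split_ifs with h
        · rw [h, Pi.single_eq_same, one_smul]; exact aeval_X ..
        · rw [Pi.single_eq_of_ne h, zero_smul, map_one, character_zero]
      rw [this, this]
  exact congrArg (fun φ : CoxRing F →ₐ[ℂ] TorusRing => φ f) this

lemma coords_scale (w : Ray F → ℂˣ) (p : MvPolynomial (Fin 2) ℂ) :
    C.coords (C.scale w p) = C.specialize w (pullback F (C.coords p)) := by
  have : C.coords.comp (C.scale w) = ((C.specialize w).comp (pullback F)).comp C.coords := by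
    refine algHom_ext fun i => ?_
    have hX : C.coords (X i) = character (C.dual i) := aeval_X ..
    simp only [AlgHom.comp_apply, scale, aeval_X]
    rw [coords_C_mul, hX, pullback_character, specialize_zMonomial, chartExponent_charExponent]
  exact congrArg (fun φ : MvPolynomial (Fin 2) ℂ →ₐ[ℂ] TorusRing => φ p) this

lemma slice_contractVolume_ray (w : Ray F → ℂˣ) {i j : Fin 2} (h : i ≠ j) :
    C.slice w (contractVolume F D Y.1 (C.ray j)) =
      MvPolynomial.C ((pairing (orthogonal (C.ray j).1) (C.ray i).1 : ℂ) *
        monomialValue w (C.coefficientExponent D (C.ray j) i)) *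
        C.scale w (C.localCoeff D i Y) := by
  apply C.coords_injective
  rw [coords_slice, C.toCoxLaurent_contractVolume_ray Y h, coords_C_mul, coords_scale, map_smul,
    map_mul, specialize_zMonomial, smul_mul_assoc, smul_smul]
  have : C.chartExponent (C.coefficientExponent D (C.ray j) i) = 0 :=
    C.eq_zero_of_pairing fun k => by
      rw [pairing_chartExponent, C.coefficientExponent_ray_eq_zero h]
  rw [this, character_zero, one_mul]

lemma slice_X_ray {w : Ray F → ℂˣ} (hw : ∀ i, w (C.ray i) = 1) (i : Fin 2) :
    C.slice w (X (C.ray i)) = X i := by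
  rw [slice, aeval_X, hw, Finset.prod_eq_single i]
  · simp
  · intro j _ hj; rw [if_neg (C.ray_ne hj)]
  · simp

lemma slice_X_of_ne (w : Ray F → ℂˣ) {ρ : Ray F} (h : ∀ i, C.ray i ≠ ρ) :
    C.slice w (X ρ) = MvPolynomial.C (w ρ : ℂ) := by
  rw [slice, aeval_X, Finset.prod_eq_one fun i _ => if_neg (h i), mul_one]

/-- The other variables are frozen to constants, and `hw` removes the chain-rule factor at the chart
variables. -/
lemma pderiv_slice {w : Ray F → ℂˣ} (hw : ∀ i, w (C.ray i) = 1) (i : Fin 2) (f : CoxRing F) :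
    pderiv i (C.slice w f) = C.slice w (pderiv (C.ray i) f) := by
  classical
  induction f using MvPolynomial.induction_on with
  | C a =>
    rw [pderiv_C, ← MvPolynomial.algebraMap_eq, AlgHom.commutes, Derivation.map_algebraMap, map_zero]
  | add p q hp hq => simp only [map_add, hp, hq]
  | mul_X p ρ hp =>
    have hX : pderiv i (C.slice w (X ρ)) = C.slice w (pderiv (C.ray i) (X ρ)) := by
      by_cases h : ∃ j, C.ray j = ρ
      · obtain ⟨j, rfl⟩ := h
        rw [C.slice_X_ray hw]
        by_cases hij : j = i
        · subst hij; simp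
        · rw [pderiv_X_of_ne hij, pderiv_X_of_ne (C.ray_ne hij), map_zero]
      · push Not at h
        rw [C.slice_X_of_ne w h, pderiv_C, pderiv_X_of_ne (h i).symm, map_zero]
    simp only [Derivation.leibniz, map_add, map_mul, hp, hX, smul_eq_mul]

lemma eval_slice {w : Ray F → ℂˣ} (hw : ∀ i, w (C.ray i) = 1) {z : Ray F → ℂ}
    (hz : ∀ ρ : Ray F, (∀ i, C.ray i ≠ ρ) → z ρ = w ρ) (f : CoxRing F) :
    eval (fun i => z (C.ray i)) (C.slice w f) = eval z f := by
  have : (aeval fun i => z (C.ray i)).comp (C.slice w) = (aeval z : CoxRing F →ₐ[ℂ] ℂ) := by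
    refine algHom_ext fun ρ => ?_
    rw [AlgHom.comp_apply, aeval_X]
    by_cases h : ∃ j, C.ray j = ρ
    · obtain ⟨j, rfl⟩ := h
      rw [C.slice_X_ray hw, aeval_X]
    · push Not at h
      rw [C.slice_X_of_ne w h, ← MvPolynomial.algebraMap_eq, AlgHom.commutes, hz ρ h]
      rfl
  exact congrArg (fun φ : CoxRing F →ₐ[ℂ] ℂ => φ f) this

lemma pderiv_scale (w : Ray F → ℂˣ) (i : Fin 2) (p : MvPolynomial (Fin 2) ℂ) :
    pderiv i (C.scale w p) =
      MvPolynomial.C (monomialValue w (charExponent F (C.dual i)) : ℂ) * C.scale w (pderiv i p) := by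
  induction p using MvPolynomial.induction_on with
  | C a =>
    rw [pderiv_C, ← MvPolynomial.algebraMap_eq, AlgHom.commutes, Derivation.map_algebraMap, map_zero,
      mul_zero]
  | add p q hp hq => simp only [map_add, hp, hq, mul_add]
  | mul_X p j hp =>
    have hX : ∀ j, C.scale w (X j) =
        MvPolynomial.C (monomialValue w (charExponent F (C.dual j)) : ℂ) * X j := fun j => aeval_X ..
    simp only [Derivation.leibniz, map_add, map_mul, hp, hX, smul_eq_mul, pderiv_C,
      mul_zero, add_zero, pderiv_X, mul_add]
    congr 1
    · by_cases h : j = i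
      · subst h; simp [mul_comm]
      · simp [h]
    · ring

lemma eval_scale (w : Ray F → ℂˣ) (q : Fin 2 → ℂ) (p : MvPolynomial (Fin 2) ℂ) :
    eval q (C.scale w p) =
      eval (fun i => (monomialValue w (charExponent F (C.dual i)) : ℂ) * q i) p := by
  induction p using MvPolynomial.induction_on with
  | C a => rw [← MvPolynomial.algebraMap_eq, AlgHom.commutes]; simp
  | add p q hp hq => simp only [map_add, hp, hq]
  | mul_X p j hp => simp only [map_mul, hp, eval_X]; simp [scale]

/-- At a singular point where the divergence of the vector field does not vanish, the exterior
derivative of the form does not vanish. -/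
lemma isKupkaPoint (h : ∀ q : Fin 2 → ℂ, (∀ i, eval q (C.localCoeff D i Y) = 0) →
      eval q (∑ i, pderiv i (C.localCoeff D i Y)) ≠ 0)
    {z : Ray F → ℂ} (hz : ∀ ρ : Ray F, ρ.1 ∉ C.cone → z ρ ≠ 0)
    (hs : IsSingularPoint F (contractVolume F D Y.1) z) :
    IsKupkaPoint F (contractVolume F D Y.1) z := by
  classical
  refine ⟨hs, C.ray 0, C.ray 1, ?_⟩
  set w : Ray F → ℂˣ := fun ρ => if h : ρ.1 ∉ C.cone then Units.mk0 (z ρ) (hz ρ h) else 1 with hwdef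
  have hw : ∀ i, w (C.ray i) = 1 := fun i => dif_neg (not_not.2 (C.ray_mem_cone i))
  have hwz : ∀ ρ : Ray F, (∀ i, C.ray i ≠ ρ) → z ρ = w ρ := by
    intro ρ hρ
    have : ρ.1 ∉ C.cone := fun hmem => by
      obtain ⟨i, hi⟩ := C.exists_ray hmem
      exact hρ i hi.symm
    rw [hwdef]
    simp [this]
  set l : Fin 2 → ℂˣ := fun i => monomialValue w (charExponent F (C.dual i)) with hl
  set q : Fin 2 → ℂ := fun i => z (C.ray i) with hq
  -- The affine coordinates of the point: `x_i` pulls back to `z_i` times a Laurent monomial in the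
  -- variables off the chart, whose value is `l i`.
  set q' : Fin 2 → ℂ := fun i => (l i : ℂ) * q i with hq'
  set c : ℂ := (pairing (orthogonal (C.ray 1).1) (C.ray 0).1 : ℂ) with hc
  have hc0 : c ≠ 0 := Int.cast_ne_zero.2 (C.pairing_orthogonal_ne_zero zero_ne_one)
  have hc' : (pairing (orthogonal (C.ray 0).1) (C.ray 1).1 : ℂ) = -c := by
    rw [hc, ← Int.cast_neg]
    congr 1
    rw [pairing_orthogonal, pairing_orthogonal]
    ring
  have hzero : ∀ i, eval q' (C.localCoeff D i Y) = 0 := by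
    intro i
    obtain ⟨j, hij⟩ : ∃ j : Fin 2, i ≠ j := ⟨1 - i, by omega⟩
    have h1 := hs.2 (C.ray j)
    rw [← C.eval_slice hw hwz, C.slice_contractVolume_ray Y w hij, map_mul, eval_C, eval_scale] at h1
    refine (mul_eq_zero.1 h1).resolve_left (mul_ne_zero ?_ (Units.ne_zero _))
    exact_mod_cast C.pairing_orthogonal_ne_zero hij
  have hdiv := h q' hzero
  -- Off the chart, `l i` cancels the term `-C.dual i` in the exponent, leaving the same monomial
  -- for both indices. This common factor turns the two derivatives in `dα` into the divergence.
  have hW : monomialValue w (C.coefficientExponent D (C.ray 1) 0) * l 0 =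
      monomialValue w (C.coefficientExponent D (C.ray 0) 1) * l 1 := by
    rw [hl, ← monomialValue_add, ← monomialValue_add]
    refine Finset.prod_congr rfl fun ρ _ => ?_
    by_cases hρ : ∃ i, C.ray i = ρ
    · obtain ⟨i, rfl⟩ := hρ
      rw [hw, one_zpow, one_zpow]
    · push Not at hρ
      congr 1
      have hm : ∀ (m : Lattice), charExponent F m ρ = pairing m ρ.1 := fun _ => rfl
      simp only [coefficientExponent, contractionDegree, Pi.add_apply, hm, pairing_sub,
        if_neg (hρ 0).symm, if_neg (hρ 1).symm]
      ring
  have hval : eval z (extDerivCoeff F (contractVolume F D Y.1) (C.ray 0) (C.ray 1)) =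
      c * (monomialValue w (C.coefficientExponent D (C.ray 1) 0) * l 0 : ℂˣ) *
        eval q' (∑ i, pderiv i (C.localCoeff D i Y)) := by
    rw [extDerivCoeff, ← C.eval_slice hw hwz, map_sub, ← C.pderiv_slice hw, ← C.pderiv_slice hw,
      C.slice_contractVolume_ray Y w zero_ne_one, C.slice_contractVolume_ray Y w one_ne_zero,
      pderiv_C_mul, pderiv_C_mul, pderiv_scale, pderiv_scale, Fin.sum_univ_two, hc', ← hc]
    simp only [map_sub, map_add, map_mul, eval_C, eval_scale]
    have hW' := congrArg (Units.val) hW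
    rw [Units.val_mul, Units.val_mul] at hW'
    rw [Units.val_mul, mul_add]
    linear_combination (-c * eval q' (pderiv 1 (C.localCoeff D 1 Y))) * hW'
  rw [hval]
  exact mul_ne_zero (mul_ne_zero hc0 (Units.ne_zero _)) hdiv

end SmoothChart

/-! ### Genericity -/

section Polynomial

variable {W : Type*} [AddCommGroup W] [Module ℂ W] [FiniteDimensional ℂ W]

lemma exists_eval_of_mem_polynomialFunctions {ι : Type*} (b : Module.Basis ι ℂ W) {f : W → ℂ}
    (hf : f ∈ polynomialFunctions W) : ∃ H : MvPolynomial ι ℂ, ∀ Y, f Y = eval (b.repr Y) H := by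
  induction hf using Algebra.adjoin_induction with
  | mem f hf =>
    obtain ⟨φ, rfl⟩ := hf
    have : Fintype ι := FiniteDimensional.fintypeBasisIndex b
    refine ⟨∑ i, MvPolynomial.C (φ (b i)) * X i, fun Y => ?_⟩
    conv_lhs => rw [← b.sum_repr Y, map_sum]
    rw [map_sum]
    exact Finset.sum_congr rfl fun i _ => by simp [mul_comm]
  | algebraMap c => exact ⟨MvPolynomial.C c, fun Y => by simp⟩
  | add f g _ _ hf hg =>
    obtain ⟨H, hH⟩ := hf
    obtain ⟨K, hK⟩ := hg
    exact ⟨H + K, fun Y => by simp [hH, hK]⟩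
  | mul f g _ _ hf hg =>
    obtain ⟨H, hH⟩ := hf
    obtain ⟨K, hK⟩ := hg
    exact ⟨H * K, fun Y => by simp [hH, hK]⟩

/-- In coordinates these are polynomials over the infinite field `ℂ`: they are determined by their
values, and they form a domain. -/
lemma prod_ne_zero_of_mem_polynomialFunctions {ι : Type*} (s : Finset ι) {f : ι → W → ℂ}
    (hf : ∀ i, f i ∈ polynomialFunctions W) (h0 : ∀ i, f i ≠ 0) :
    ∏ i ∈ s, f i ≠ 0 := by
  choose H hH using fun i => exists_eval_of_mem_polynomialFunctions (Module.finBasis ℂ W) (hf i)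
  have hH0 : ∀ i, H i ≠ 0 := by
    intro i h
    exact h0 i (funext fun Y => by rw [hH, h, map_zero]; rfl)
  intro hprod
  refine (Finset.prod_ne_zero_iff (s := s)).2 (fun i _ => hH0 i) (MvPolynomial.funext fun c => ?_)
  have := congrFun hprod ((Module.finBasis ℂ W).repr.symm (Finsupp.equivFunOnFinite.symm c))
  rw [Finset.prod_apply] at this
  simpa [hH] using this

/-- Finitely many nonzero polynomial functions are simultaneously nonzero on a nonempty Zariski open
set. -/
lemma exists_isZariskiOpen_forall_ne_zero {ι : Type*} [Fintype ι] {f : ι → W → ℂ}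
    (hf : ∀ i, f i ∈ polynomialFunctions W) (h0 : ∀ i, ∃ Y, f i Y ≠ 0) :
    ∃ U : Set W, IsZariskiOpen U ∧ U.Nonempty ∧ ∀ Y ∈ U, ∀ i, f i Y ≠ 0 := by
  have hprod := prod_ne_zero_of_mem_polynomialFunctions Finset.univ hf fun i h => by
    obtain ⟨Y, hY⟩ := h0 i
    exact hY (congrFun h Y)
  refine ⟨{Y | (∏ i, f i) Y ≠ 0}, ⟨{∏ i, f i}, ?_, ?_⟩, Function.ne_iff.1 hprod, fun Y hY i => ?_⟩
  · rintro _ rfl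
    exact Subalgebra.prod_mem _ fun i _ => hf i
  · ext Y; simp
  · rw [Set.mem_ofPred_eq, Finset.prod_apply, Finset.prod_ne_zero_iff] at hY
    exact hY i (Finset.mem_univ i)

end Polynomial

/-- If `TX(D)` is globally generated, then the zeros on a chart of its general global section are
nondegenerate, and the divergence does not vanish at them. -/
lemma SmoothChart.exists_polynomialFunction {F : SmoothCompleteFan} (C : SmoothChart F)
    {D : Ray F → ℤ} (hD : TangentGloballyGenerated F D) :
    ∃ f : globalTangentSections F D → ℂ, f ∈ polynomialFunctions (globalTangentSections F D) ∧
      (∃ Y, f Y ≠ 0) ∧ ∀ Y, f Y ≠ 0 → ∀ q : Fin 2 → ℂ, (∀ i, eval q (C.localCoeff D i Y) = 0) →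
        eval q (Matrix.of fun i k => pderiv k (C.localCoeff D i Y)).det ≠ 0 ∧
        eval q (∑ i, pderiv i (C.localCoeff D i Y)) ≠ 0 := by
  have h := exists_polynomialFunction_nondegenerate (W := globalTangentSections F D)
    (C.localCoeff D)
  exact h (fun i => ⟨C.coordinateField D i, C.coordinateField_mem D hD i⟩)
    (C.localCoeff_coordinateField D hD) (C.exists_divergence_ne_zero D hD)

end ToricSurface

end

theorem theorem5p16 (F : ToricSurface.SmoothCompleteFan) (D : ToricSurface.Ray F → ℤ)
    (hD : ToricSurface.TangentGloballyGenerated F D) :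
    ∃ U : Set (ToricSurface.globalTangentSections F D),
      ToricSurface.IsZariskiOpen U ∧ U.Nonempty ∧
      ∀ Y ∈ U,
        ToricSurface.SubschemeReduced F
          (ToricSurface.singularIdeal F (ToricSurface.contractVolume F D Y.1)) ∧
        ∀ z : ToricSurface.Ray F → ℂ,
          ToricSurface.IsSingularPoint F (ToricSurface.contractVolume F D Y.1) z →
          ToricSurface.IsKupkaPoint F (ToricSurface.contractVolume F D Y.1) z := by
  -- Each cone is placed in a two-dimensional one; there are finitely many, so the open conditions
  -- can be imposed together.
  choose C hC using fun σ : {σ // σ ∈ F.cones} => ToricSurface.exists_smoothChart_of_mem_cones σ.2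
  choose f hf hf0 hfY using fun σ : {σ // σ ∈ F.cones} =>
    (C σ).exists_polynomialFunction hD
  obtain ⟨U, hU, hne, hUY⟩ := ToricSurface.exists_isZariskiOpen_forall_ne_zero hf hf0
  refine ⟨U, hU, hne, fun Y hY => ⟨fun σ hσ => (C ⟨σ, hσ⟩).isReduced_quotient_chartIdeal Y
    (hC ⟨σ, hσ⟩) fun q hq => (hfY ⟨σ, hσ⟩ Y (hUY Y hY _) q hq).1, fun z hz => ?_⟩⟩
  obtain ⟨σ, hσ, hzσ⟩ := hz.1
  exact (C ⟨σ, hσ⟩).isKupkaPoint Y (fun q hq => (hfY ⟨σ, hσ⟩ Y (hUY Y hY _) q hq).2)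
    (fun ρ hρ => hzσ ρ fun hmem => hρ (hC ⟨σ, hσ⟩ hmem)) hz
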